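/- Let $D_r=\{z\in\mathbb C: 0<|z|\le r\}$. Let $E$ be a complete minimal annular end that is conformally a punctured disk: a map $X:D_1\to\mathbb R^3$, continuous on $D_1$, whose restriction to $\{0<|z|<1\}$ is a conformal minimal immersion of class $C^2$ that is complete at the puncture (every $C^1$ curve in $\{0<|z|<1\}$ tending to $0$ has an image of infinite length). Let $g$ be the stereographic projection of the Gauss map of $X$, and let $dh=\left(\partial_x x_3-i\,\partial_y x_3\right)dz$ (so $dh$ is the holomorphic one-form with $\mathrm{Re}\,dh=dx_3$). Suppose that $dg/g$ and $dh$ both have double poles at the puncture $0$ and that $dh$ has residue $0$ there. Suppose that $X(D_1)$ contains a vertical ray and a horizontal ray. Then there is $r\in(0,1]$ such that the sub-end $X|_{D_r}$ is embedded and is asymptotic to a helicoid $H$ in the following sense: for each $\varepsilon>0$ there is $\delta\in(0,r]$ such that $X(D_\delta)$ lies in the $\varepsilon$-neighborhood of $H$, and there is $R$ such that $\{q\in H:|q|>R\}$ lies in the $\varepsilon$-neighborhood of $X(D_r)$. Here a helicoid is a surface swept out by a line that meets a fixed line orthogonally and that rotates with constant nonzero speed as it moves along that fixed line. In particular, the genus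 one helicoid is embedded outside a compact subset of $\mathbb R^3$. That is, let $\Lambda\subset\mathbb C$ be any lattice and let $Y$ be any complete conformal minimal immersion into $\mathbb R^3$ of the torus $\mathbb C/\Lambda$ punctured at $0$, such that $dg/g$ and $dh$ have double poles at the puncture, $dh$ has residue $0$ there, and the surface contains a vertical line and a horizontal line that intersect. Then there is a compact $K\subset\mathbb R^3$ such that $Y$ is an embedding of $Y^{-1}(\mathbb R^3\setminus K)$. -/

import Mathlib

open Filter Topology MeasureTheory
open scoped Matrix

noncomputable section

namespace HelicoidEnd

/-- Euclidean three-space; the coordinates `x₁, x₂, x₃` are `p 0, p 1, p 2`. -/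
abbrev E3 : Type := EuclideanSpace ℝ (Fin 3)

/-! ### Conformally parametrised minimal surfaces -/

/-- The partial derivative of `X` in the direction `v`, for a map on (a part of) the plane `ℂ`.
`v = 1` gives `∂/∂x` and `v = Complex.I` gives `∂/∂y`. -/
def partialD (X : ℂ → E3) (v : ℂ) (z : ℂ) : E3 := fderiv ℝ X z v

/-- The unit normal `(X_x × X_y) / |X_x × X_y|`. -/
def unitNormal (X : ℂ → E3) (z : ℂ) : E3 :=
  let n : E3 := WithLp.toLp 2
    (WithLp.ofLp (partialD X 1 z) ⨯₃ WithLp.ofLp (partialD X Complex.I z))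
  ‖n‖⁻¹ • n

/-- The mean curvature `(e G - 2 f F + g E) / (2 (E G - F²))`, from the coefficients `E, F, G` of
the first and `e, f, g` of the second fundamental form. -/
def meanCurvature (X : ℂ → E3) (z : ℂ) : ℝ :=
  let Xx := partialD X 1 z
  let Xy := partialD X Complex.I z
  let N := unitNormal X z
  let E := inner ℝ Xx Xx
  let F := inner ℝ Xx Xy
  let G := inner ℝ Xy Xy
  let e := inner ℝ (partialD (partialD X 1) 1 z) N
  let f := inner ℝ (partialD (partialD X 1) Complex.I z) N
  let g := inner ℝ (partialD (partialD X Complex.I) Complex.I z) N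
  (e * G - 2 * f * F + g * E) / (2 * (E * G - F ^ 2))

/-- `X` is a conformal minimal immersion of the open set `U ⊆ ℂ`. (`ConformalAt` says that the
differential is a nonzero multiple of an isometric embedding, so that `X` is an immersion.) -/
structure IsConformalMinimalImmersionOn (X : ℂ → E3) (U : Set ℂ) : Prop where
  contDiffOn : ContDiffOn ℝ 2 X U
  conformalAt : ∀ z ∈ U, ConformalAt X z
  meanCurvature_eq_zero : ∀ z ∈ U, meanCurvature X z = 0

/-- Completeness at the puncture `0`: every `C¹` curve in `U` that tends to the puncture has an
image of infinite length. -/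
def IsCompleteAtPuncture (X : ℂ → E3) (U : Set ℂ) : Prop :=
  ∀ c : ℝ → ℂ, ContDiffOn ℝ 1 c (Set.Ici 0) → (∀ t ∈ Set.Ici (0 : ℝ), c t ∈ U) →
    Tendsto c atTop (𝓝 0) → ∫⁻ t in Set.Ioi (0 : ℝ), ‖deriv (fun s => X (c s)) t‖ₑ = ⊤

/-! ### Weierstrass data -/

/-- The Gauss map followed by stereographic projection from the north pole. (Where the normal is
the north pole, a pole of the Gauss map, the value is `0` by the convention for division.) -/
def gaussMap (X : ℂ → E3) (z : ℂ) : ℂ :=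
  ((unitNormal X z 0 : ℂ) + Complex.I * (unitNormal X z 1 : ℂ)) / (1 - (unitNormal X z 2 : ℂ))

/-- The coefficient of `dh` with respect to `dz`: if `x₃ = Re h` with `h` holomorphic, then
`dh = (∂x₃/∂x - i ∂x₃/∂y) dz`. -/
def heightForm (X : ℂ → E3) (z : ℂ) : ℂ :=
  (partialD X 1 z 2 : ℂ) - Complex.I * (partialD X Complex.I z 2 : ℂ)

/-- The form `ω dz` has a double pole at `0`. -/
def HasDoublePole (ω : ℂ → ℂ) : Prop := meromorphicOrderAt ω 0 = ((-2 : ℤ) : WithTop ℤ)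

/-- The form `ω dz`, holomorphic in a punctured neighbourhood of `0`, has residue zero at `0`. -/
def HasNoResidue (ω : ℂ → ℂ) : Prop := ∀ᶠ r in 𝓝[>] (0 : ℝ), (∮ z in C(0, r), ω z) = 0

/-! ### Annular ends -/

/-- The punctured disk `{0 < |z| ≤ r}`; its circle `|z| = r` is the boundary curve of the end. -/
def puncturedDisk (r : ℝ) : Set ℂ := {z | 0 < ‖z‖ ∧ ‖z‖ ≤ r}

/-- The interior `{0 < |z| < 1}` of the punctured disk `puncturedDisk 1`. -/
def openPuncturedDisk : Set ℂ := {z | 0 < ‖z‖ ∧ ‖z‖ < 1}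

/-- `X` parametrises conformally, by the punctured disk `{0 < |z| ≤ 1}`, a complete minimal
annular end, with compact boundary curve `X (|z| = 1)`. Its sub-ends are the restrictions of `X`
to `{0 < |z| ≤ r}`. -/
structure IsCompleteMinimalAnnularEnd (X : ℂ → E3) : Prop where
  continuousOn : ContinuousOn X (puncturedDisk 1)
  minimal : IsConformalMinimalImmersionOn X openPuncturedDisk
  complete : IsCompleteAtPuncture X openPuncturedDisk

/-- `v` is a direction vector of a vertical line. -/
def IsVertical (v : E3) : Prop := v ≠ 0 ∧ v 0 = 0 ∧ v 1 = 0

/-- `v` is a direction vector of a horizontal line. -/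
def IsHorizontal (v : E3) : Prop := v ≠ 0 ∧ v 2 = 0

/-- The ray from `p` in the direction `v`. -/
def ray (p v : E3) : Set E3 := {q | ∃ s : ℝ, 0 ≤ s ∧ q = p + s • v}

/-- The line through `p` in the direction `v`. -/
def line (p v : E3) : Set E3 := {q | ∃ s : ℝ, q = p + s • v}

/-! ### Helicoids and asymptotics -/

/-- `H` is a helicoid: swept out by a line that meets a fixed line, the axis `p + ℝ e₃`,
orthogonally, and that rotates with constant nonzero speed as it moves along the axis. -/
def IsHelicoid (H : Set E3) : Prop :=
  ∃ (p : E3) (e : OrthonormalBasis (Fin 3) ℝ E3) (c : ℝ), c ≠ 0 ∧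
    H = {q | ∃ s t : ℝ,
      q = p + s • (Real.cos t • e 0 + Real.sin t • e 1) + (c * t) • e 2}

/-- The end `X` on `{0 < |z| ≤ r}` is asymptotic to the surface `H`: for each `ε > 0`, some
sub-end lies in the `ε`-neighbourhood of `H`, and the part of `H` outside some ball lies in the
`ε`-neighbourhood of the end. -/
def IsAsymptoticTo (X : ℂ → E3) (r : ℝ) (H : Set E3) : Prop :=
  ∀ ε > 0,
    (∃ δ ∈ Set.Ioc 0 r, ∀ z ∈ puncturedDisk δ, ∃ q ∈ H, dist (X z) q < ε) ∧
    (∃ R : ℝ, ∀ q ∈ H, R < ‖q‖ → ∃ z ∈ puncturedDisk r, dist q (X z) < ε)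

/-- The sub-end of `X` on `{0 < |z| ≤ r}` is embedded (it is an immersion by definition). -/
def IsEmbeddedSubEnd (X : ℂ → E3) (r : ℝ) : Prop :=
  IsEmbedding (fun z : puncturedDisk r => X z)

/-! ### The genus one helicoid -/

/-- The lift to `ℂ` of a map on the torus `ℂ ⧸ Λ`, where `Λ` is the lattice of `L`. -/
def torusLift (L : PeriodPair) (Y : ℂ ⧸ L.lattice → E3) (z : ℂ) : E3 :=
  Y (L.lattice.mkQ z)

/-- The plane without the lattice: the preimage in `ℂ` of the torus punctured at `0`. -/
def puncturedPlane (L : PeriodPair) : Set ℂ := {z | z ∉ L.lattice}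

/-- The torus `ℂ ⧸ Λ` punctured at the point `0`. -/
def puncturedTorus (L : PeriodPair) : Set (ℂ ⧸ L.lattice) := {p | p ≠ 0}

/-- `Y` is a genus one helicoid, conformally parametrised by the torus `ℂ ⧸ Λ` punctured at `0`
(the value `Y 0` plays no role): a complete minimal surface with `dg/g` and `dh` having double
poles and `dh` having no residue at the puncture, which contains a vertical line and a horizontal
line that meet. A curve in the punctured torus that tends to the puncture has a lift to `ℂ` that
tends to `0`. -/
structure IsGenusOneHelicoid (L : PeriodPair) (Y : ℂ ⧸ L.lattice → E3) : Prop where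
  minimal : IsConformalMinimalImmersionOn (torusLift L Y) (puncturedPlane L)
  complete : IsCompleteAtPuncture (torusLift L Y) (puncturedPlane L)
  doublePole_gauss : HasDoublePole (logDeriv (gaussMap (torusLift L Y)))
  doublePole_height : HasDoublePole (heightForm (torusLift L Y))
  noResidue_height : HasNoResidue (heightForm (torusLift L Y))
  lines : ∃ p v w : E3, IsVertical v ∧ IsHorizontal w ∧
    line p v ⊆ Y '' puncturedTorus L ∧ line p w ⊆ Y '' puncturedTorus L

/-- The part of the surface `Y` that lies outside `K` is embedded. -/
def IsEmbeddedOutside (L : PeriodPair) (Y : ℂ ⧸ L.lattice → E3) (K : Set E3) : Prop :=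
  IsEmbedding (fun p : {p : ℂ ⧸ L.lattice // p ∈ puncturedTorus L ∧ Y p ∉ K} => Y p)

end HelicoidEnd

end

/-!
Why the theorem is true. Put `W = x₁ + i x₂`. The double pole of `dh` and its vanishing residue make
`u = ∫ dh` a coordinate of the end at infinity, so that near the puncture the surface is
`u ↦ (W u, Re u)`, `R < |u|`, with `dh = du` and
`dW(v) = (conj (v / G) - G v) / 2` for the Gauss map `G` (`hasFDerivAt_horizontal`,
`exists_endChart`). The double pole of `dg/g` says that `G' / G = L (1 / u)` with `L` analytic at `0`
and `L 0 ≠ 0`.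

A vertical ray makes an uncountable closed set on which `W` is constant, and by the
Cantor–Bendixson theorem this set contains a perfect set. At an accumulation point of a fibre of `W`
the differential of `W` is degenerate, which forces `|G| = 1` and a horizontal tangent of the fibre.
Hence, on the perfect set, a function that vanishes there has a vanishing `x`-derivative there; from
`log |G| = 0` it follows inductively that all derivatives of `G' / G` are purely imaginary. So
`Re (G' / G)` vanishes along a horizontal half-line, the axis (`IsEndData.exists_axis`), which a
translation moves to the real axis.

By reflection the coefficients of `L` are purely imaginary. The residue of `G' / G` at infinity is
zero since otherwise `|G|`, corrected by an exponential of the angle, would not be single valued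
(`residue_eq_zero`). Therefore `G = exp (i (τ u + c) + o(1))` with real `τ ≠ 0` and `c`, and the
reflection in the real axis is induced by the half-turn of the surface about its axis
(`IsEndData.exists_gauss_eq_exp`, `IsEndData.horizontal_conj`). After a similarity this says that
`V`, the normalised `W`, vanishes on the real axis, is odd under reflection, and moves along each
vertical line `Re u = x` with speed at least `1` in a direction that tends to `exp (i x)` at infinity:
this is `IsHelicoidal`.

So each horizontal section of the end is nearly a straight line, in the direction in which the
helicoid `{(s exp (i x), x)}` is cut at height `x`. A curve whose direction stays in a half plane is
injective, which gives embeddedness (`IsHelicoidal.exists_injOn`); integrating the direction gives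
properness and, because an error in the direction amounts to a small change of the height `x`, both
halves of the asymptotic statement (`IsHelicoidal.exists_eq_mul_exp`, `IsHelicoidal.exists_of_far`).

For the punctured torus the same applies to a small disk around the puncture. The rest of the surface
is bounded, hence outside a large ball only the embedded end is left.
-/

noncomputable section

namespace HelicoidEnd

/-! ### Planar maps that look like a helicoid near infinity -/

/-- The map `V`, defined on `{R < |u|}`, is such that `u ↦ (V u, Re u)` is close to the helicoid
`u ↦ (exp (i x) sinh y, x)`, `u = x + i y`: it is odd under reflection in the real axis, and on each
line `Re u = x` it moves with speed at least `1` in a direction that makes an angle with `exp (i x)`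
which tends to `0` at infinity. -/
structure IsHelicoidal (V : ℂ → ℂ) (R : ℝ) : Prop where
  continuousOn : ContinuousOn V {u | R < ‖u‖}
  map_conj : ∀ u, R < ‖u‖ → V (starRingEnd ℂ u) = -V u
  slope : ∀ ε > 0, ∃ B ≥ R, ∀ u : ℂ, B < ‖u‖ → ∃ c θ : ℝ, 1 ≤ c ∧ |θ| ≤ ε ∧
    HasDerivAt (fun y : ℝ => V ⟨u.re, y⟩) (c * Complex.exp (Complex.I * ((u.re + θ : ℝ) : ℂ))) u.im

theorem mul_sub_le_of_hasDerivAt_ge {f : ℝ → ℝ} {a b m : ℝ} (hab : a ≤ b)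
    (h : ∀ y ∈ Set.Icc a b, ∃ d ≥ m, HasDerivAt f d y) : m * (b - a) ≤ f b - f a := by
  refine (convex_Icc a b).mul_sub_le_image_sub_of_le_deriv
    (fun y hy => ?_) (fun y hy => ?_) (fun y hy => ?_) a
    (Set.left_mem_Icc.2 hab) b (Set.right_mem_Icc.2 hab) hab
  · obtain ⟨d, -, hd⟩ := h y hy
    exact hd.continuousAt.continuousWithinAt
  · obtain ⟨d, -, hd⟩ := h y (interior_subset hy)
    exact hd.differentiableAt.differentiableWithinAt
  · obtain ⟨d, hd', hd⟩ := h y (interior_subset hy)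
    rwa [hd.deriv]

theorem le_norm_mk {x y : ℝ} {b : ℝ} (h : b < |x| ∨ b < |y|) : b < ‖(⟨x, y⟩ : ℂ)‖ := by
  rcases h with h | h
  · exact h.trans_le (Complex.abs_re_le_norm ⟨x, y⟩)
  · exact h.trans_le (Complex.abs_im_le_norm ⟨x, y⟩)

theorem norm_exp_I_mul (x : ℝ) : ‖Complex.exp (Complex.I * x)‖ = 1 := by
  rw [mul_comm]; exact Complex.norm_exp_ofReal_mul_I x

theorem abs_arctan_le (x : ℝ) : |Real.arctan x| ≤ |x| := by
  wlog hx : 0 ≤ x generalizing x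
  · have := this (-x) (by linarith)
    rwa [Real.arctan_neg, abs_neg, abs_neg] at this
  · have h := Real.arctan_nonneg.2 hx
    rw [abs_of_nonneg hx, abs_of_nonneg h]
    simpa [Real.tan_arctan] using Real.le_tan h (Real.arctan_lt_pi_div_two x)

/-- The root of a family of strictly increasing functions depends continuously on the parameter. -/
theorem continuousOn_of_strictMonoOn_root {f : ℝ → ℝ → ℝ} {S : Set ℝ} {y₀ s : ℝ} {r : ℝ → ℝ}
    (hmono : ∀ x ∈ S, StrictMonoOn (f x) (Set.Ici y₀))
    (hcont : ∀ y ≥ y₀, ContinuousOn (fun x => f x y) S)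
    (hr : ∀ x ∈ S, y₀ < r x ∧ f x (r x) = s) : ContinuousOn r S := by
  intro x hx
  refine tendsto_order.2 ⟨fun a ha => ?_, fun b hb => ?_⟩
  · have hlt : max a y₀ < r x := max_lt ha (hr x hx).1
    have h1 : f x (max a y₀) < s := by
      rw [← (hr x hx).2]
      exact hmono x hx (Set.mem_Ici.2 (le_max_right a y₀)) (hr x hx).1.le hlt
    filter_upwards [(hcont _ (le_max_right a y₀) x hx).eventually_lt_const h1,
      self_mem_nhdsWithin] with x' h2 hx'
    by_contra! hle
    have := (hmono x' hx').monotoneOn (hr x' hx').1.le (Set.mem_Ici.2 (le_max_right a y₀))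
      (hle.trans (le_max_left _ _))
    rw [(hr x' hx').2] at this
    linarith
  · have hby : y₀ ≤ b := ((hr x hx).1.trans hb).le
    have h1 : s < f x b := by
      rw [← (hr x hx).2]
      exact hmono x hx (hr x hx).1.le hby hb
    filter_upwards [(hcont _ hby x hx).eventually_const_lt h1, self_mem_nhdsWithin] with x' h2 hx'
    by_contra! hle
    have := (hmono x' hx').monotoneOn hby (hr x' hx').1.le hle
    rw [(hr x' hx').2] at this
    linarith

namespace IsHelicoidal

variable {V : ℂ → ℂ} {R : ℝ}

theorem apply_ofReal (hV : IsHelicoidal V R) {x : ℝ} (hx : R < |x|) : V x = 0 := by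
  have h := hV.map_conj x (by simpa using hx)
  rw [Complex.conj_ofReal] at h
  have : 2 * V x = 0 := by linear_combination h
  simpa using this

/-- On a horizontal segment above the real axis that stays in the domain, `V` is bounded. -/
theorem exists_bound (hV : IsHelicoidal V R) (b : ℝ) {y : ℝ} (hy : R < |y|) :
    ∃ M > 0, ∀ x : ℝ, |x| ≤ b → ‖V ⟨x, y⟩‖ ≤ M := by
  have hc : ContinuousOn (fun x : ℝ => V ⟨x, y⟩) (Set.Icc (-b) b) := by
    refine hV.continuousOn.comp (t := {u | R < ‖u‖}) ?_ fun x _ => le_norm_mk (Or.inr hy)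
    have : (fun x : ℝ => (⟨x, y⟩ : ℂ)) = fun x : ℝ => (x : ℂ) + y * Complex.I := by
      ext x : 1; exact Complex.mk_eq_add_mul_I x y
    rw [this]
    fun_prop
  obtain ⟨M, hM⟩ := isCompact_Icc.exists_bound_of_continuousOn hc
  exact ⟨max M 1, by positivity, fun x hx => (hM x (abs_le.1 hx)).trans (le_max_left _ _)⟩

theorem hasDerivAt_re_mul (a : ℂ) {u : ℂ} {c θ : ℝ}
    (h : HasDerivAt (fun y : ℝ => V ⟨u.re, y⟩)
      (c * Complex.exp (Complex.I * ((u.re + θ : ℝ) : ℂ))) u.im) :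
    HasDerivAt (fun y : ℝ => (a * V ⟨u.re, y⟩).re)
      (c * (a * Complex.exp (Complex.I * ((u.re + θ : ℝ) : ℂ))).re) u.im := by
  have h1 := (Complex.reCLM.hasFDerivAt.comp_hasDerivAt u.im (h.const_mul a))
  have h2 : Complex.reCLM (a * (c * Complex.exp (Complex.I * ((u.re + θ : ℝ) : ℂ)))) =
      c * (a * Complex.exp (Complex.I * ((u.re + θ : ℝ) : ℂ))).re := by
    rw [Complex.reCLM_apply, ← Complex.re_ofReal_mul]
    congr 1
    ring
  rw [← h2]
  exact h1

/-- In the upper half plane the value of `V` lies in a narrow sector around the direction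
`exp (i x)`, and it grows at least linearly along vertical lines. -/
theorem sector (hV : IsHelicoidal V R) {ε : ℝ} (hε : 0 < ε) (hε1 : ε ≤ 1) :
    ∃ B ≥ R, ∃ C : ℝ, ∀ u : ℂ, B < ‖u‖ → 0 < u.im →
      |(Complex.exp (Complex.I * ((-u.re : ℝ) : ℂ)) * V u).im| <
        ε * (Complex.exp (Complex.I * ((-u.re : ℝ) : ℂ)) * V u).re ∧
      ε / 2 * u.im - C ≤ ε * (Complex.exp (Complex.I * ((-u.re : ℝ) : ℂ)) * V u).re := by
  obtain ⟨A₀, hA₀, hs⟩ := hV.slope (ε / 4) (by positivity)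
  set A := max A₀ 0 + 1 with hA
  have hAA : A₀ < A := by rw [hA]; linarith [le_max_left A₀ 0]
  have hA1 : 1 ≤ A := by rw [hA]; linarith [le_max_right A₀ 0]
  obtain ⟨M, hM0, hM⟩ := hV.exists_bound A (y := A)
    (by rw [abs_of_pos (by linarith)]; linarith)
  -- the two linear functionals `ε Re ± Im` increase along vertical lines at rate at least `ε / 2`
  have key : ∀ σ : ℝ, |σ| = 1 → ∀ u : ℂ, (A + (A + 4 * M / ε)) < ‖u‖ → 0 < u.im →
      0 < ε * (Complex.exp (Complex.I * ((-u.re : ℝ) : ℂ)) * V u).re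
        + σ * (Complex.exp (Complex.I * ((-u.re : ℝ) : ℂ)) * V u).im ∧
      ε / 2 * u.im - (2 * M + ε / 2 * A) ≤
        ε * (Complex.exp (Complex.I * ((-u.re : ℝ) : ℂ)) * V u).re
        + σ * (Complex.exp (Complex.I * ((-u.re : ℝ) : ℂ)) * V u).im := by
    intro σ hσ u hu hy
    set x := u.re with hx
    set a : ℂ := ⟨ε, -σ⟩ * Complex.exp (Complex.I * ((-x : ℝ) : ℂ)) with ha
    have hf : ∀ w : ℂ, ε * (Complex.exp (Complex.I * ((-x : ℝ) : ℂ)) * w).re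
        + σ * (Complex.exp (Complex.I * ((-x : ℝ) : ℂ)) * w).im = (a * w).re := by
      intro w
      rw [ha, mul_assoc, Complex.mul_re ⟨ε, -σ⟩]
      ring
    have hder : ∀ y : ℝ, (A₀ < |x| ∨ A₀ < |y|) →
        ∃ d ≥ ε / 2, HasDerivAt (fun y : ℝ => (a * V ⟨x, y⟩).re) d y := by
      intro y hxy
      obtain ⟨c, θ, hc, hθ, hd⟩ := hs ⟨x, y⟩ (le_norm_mk hxy)
      refine ⟨_, ?_, hasDerivAt_re_mul (u := ⟨x, y⟩) a hd⟩
      have : a * Complex.exp (Complex.I * ((x + θ : ℝ) : ℂ)) =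
          ⟨ε, -σ⟩ * Complex.exp (θ * Complex.I) := by
        rw [ha, mul_assoc, ← Complex.exp_add]
        congr 2
        push_cast
        ring
      simp only [this, Complex.mul_re, Complex.exp_ofReal_mul_I_re, Complex.exp_ofReal_mul_I_im]
      have hcos : 1 - θ ^ 2 / 2 ≤ Real.cos θ := Real.one_sub_sq_div_two_le_cos
      have hθ2 : θ ^ 2 ≤ (1 / 4) ^ 2 := by
        rw [← sq_abs]
        gcongr
        linarith
      have hsin : |σ * Real.sin θ| ≤ ε / 4 := by
        rw [abs_mul, hσ, one_mul]
        exact Real.abs_sin_le_abs.trans hθ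
      have h1 := (abs_le.1 hsin).1
      have : ε / 2 ≤ ε * Real.cos θ - -σ * Real.sin θ := by nlinarith
      nlinarith
    have hyu : (⟨x, u.im⟩ : ℂ) = u := Complex.eta u
    rw [hf]
    by_cases hxA : A ≤ |x|
    · have h := mul_sub_le_of_hasDerivAt_ge (f := fun y : ℝ => (a * V ⟨x, y⟩).re) (m := ε / 2)
        hy.le fun y _ => hder y (Or.inl (by linarith))
      have h0 : V ⟨x, 0⟩ = 0 := hV.apply_ofReal (by linarith)
      simp only [h0, hyu, mul_zero, Complex.zero_re, sub_zero] at h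
      constructor
      · have : 0 < ε / 2 * u.im := by positivity
        linarith
      · have : 0 < ε / 2 * A := by positivity
        linarith
    · push Not at hxA
      have hyl : A + 4 * M / ε < u.im := by
        have := Complex.norm_le_abs_re_add_abs_im u
        rw [← hx, abs_of_pos hy] at this
        linarith
      have hq : 0 < 4 * M / ε := by positivity
      have h := mul_sub_le_of_hasDerivAt_ge (f := fun y : ℝ => (a * V ⟨x, y⟩).re) (m := ε / 2)
        (a := A) (b := u.im) (by linarith) fun y hy' => hder y
          (Or.inr (by rw [abs_of_pos (by linarith [hy'.1])]; linarith [hy'.1]))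
      have hb : -(2 * M) ≤ (a * V ⟨x, A⟩).re := by
        have h1 : ‖a * V ⟨x, A⟩‖ ≤ 2 * M := by
          rw [norm_mul]
          have h2 : ‖a‖ ≤ 2 := by
            rw [ha, norm_mul, norm_exp_I_mul, mul_one]
            refine (Complex.norm_le_abs_re_add_abs_im _).trans ?_
            simp only [abs_neg, hσ, abs_of_pos hε]
            linarith
          have := hM x hxA.le
          gcongr
        linarith [(abs_le.1 ((Complex.abs_re_le_norm _).trans h1)).1]
      simp only [hyu] at h
      have h3 : 4 * M / ε * (ε / 2) = 2 * M := by field_simp; norm_num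
      constructor <;> nlinarith
  refine ⟨A + (A + 4 * M / ε), ?_, 2 * M + ε / 2 * A, fun u hu hy => ?_⟩
  · have : 0 < 4 * M / ε := by positivity
    linarith
  · obtain ⟨h1, h2⟩ := key 1 (by simp) u hu hy
    obtain ⟨h3, h4⟩ := key (-1) (by simp) u hu hy
    refine ⟨abs_lt.2 ⟨by linarith, by linarith⟩, by linarith⟩

/-- Near infinity, `V` is injective on vertical lines. -/
theorem exists_injOn (hV : IsHelicoidal V R) :
    ∃ B ≥ R, ∀ u₁ u₂ : ℂ, B < ‖u₁‖ → B < ‖u₂‖ → u₁.re = u₂.re → V u₁ = V u₂ → u₁ = u₂ := by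
  obtain ⟨B₁, hB₁, C, hsec⟩ := hV.sector one_pos le_rfl
  obtain ⟨B₂, hB₂, hs⟩ := hV.slope (1 / 4) (by norm_num)
  have hpos : ∀ u : ℂ, B₁ < ‖u‖ → 0 < u.im →
      0 < (Complex.exp (Complex.I * ((-u.re : ℝ) : ℂ)) * V u).re := fun u hu hy => by
    have := (hsec u hu hy).1
    rw [one_mul] at this
    exact (abs_nonneg _).trans_lt this
  have hneg : ∀ u : ℂ, B₁ < ‖u‖ → u.im < 0 →
      (Complex.exp (Complex.I * ((-u.re : ℝ) : ℂ)) * V u).re < 0 := fun u hu hy => by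
    have := hpos (starRingEnd ℂ u) (by simpa using hu) (by simpa using hy)
    rw [hV.map_conj u (by linarith), Complex.conj_re, mul_neg, Complex.neg_re] at this
    linarith
  have hzero : ∀ u : ℂ, B₁ < ‖u‖ → u.im = 0 →
      (Complex.exp (Complex.I * ((-u.re : ℝ) : ℂ)) * V u).re = 0 := fun u hu hy => by
    have hu' : u = (u.re : ℂ) := Complex.ext rfl (by simpa using hy)
    have : V u = 0 := by
      rw [hu']
      refine hV.apply_ofReal ?_
      rw [hu', Complex.norm_real, Real.norm_eq_abs] at hu
      linarith
    simp [this]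
  have hup : ∀ u₁ u₂ : ℂ, max B₁ B₂ < ‖u₁‖ → max B₁ B₂ < ‖u₂‖ → u₁.re = u₂.re → 0 < u₁.im →
      u₁.im < u₂.im → V u₁ ≠ V u₂ := by
    intro u₁ u₂ h₁ h₂ hre hy hlt heq
    have h := mul_sub_le_of_hasDerivAt_ge
      (f := fun y : ℝ => (Complex.exp (Complex.I * ((-u₁.re : ℝ) : ℂ)) * V ⟨u₁.re, y⟩).re)
      (m := 1 / 2) hlt.le fun y hy' => ?_
    · have e1 : (⟨u₁.re, u₁.im⟩ : ℂ) = u₁ := Complex.eta _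
      have e2 : (⟨u₁.re, u₂.im⟩ : ℂ) = u₂ := by rw [hre]
      simp only [e1, e2, heq, sub_self] at h
      linarith
    · have hn : B₂ < ‖(⟨u₁.re, y⟩ : ℂ)‖ := by
        refine ((le_max_right _ _).trans_lt h₁).trans_le ?_
        rw [Complex.norm_def, Complex.norm_def]
        apply Real.sqrt_le_sqrt
        simp only [Complex.normSq_apply]
        nlinarith [hy'.1]
      obtain ⟨c, θ, hc, hθ, hd⟩ := hs _ hn
      refine ⟨_, ?_, hasDerivAt_re_mul (u := ⟨u₁.re, y⟩) _ hd⟩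
      rw [← Complex.exp_add]
      have : Complex.I * ((-u₁.re : ℝ) : ℂ) + Complex.I * ((u₁.re + θ : ℝ) : ℂ)
          = θ * Complex.I := by push_cast; ring
      simp only [this, Complex.exp_ofReal_mul_I_re]
      have hcos : 1 - θ ^ 2 / 2 ≤ Real.cos θ := Real.one_sub_sq_div_two_le_cos
      have hθ2 : θ ^ 2 ≤ (1 / 4) ^ 2 := by
        rw [← sq_abs]
        gcongr
      nlinarith
  refine ⟨max B₁ B₂, hB₁.trans (le_max_left _ _), fun u₁ u₂ h₁ h₂ hre heq => ?_⟩
  have h₁' := (le_max_left B₁ B₂).trans_lt h₁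
  have h₂' := (le_max_left B₁ B₂).trans_lt h₂
  have hQ : (Complex.exp (Complex.I * ((-u₁.re : ℝ) : ℂ)) * V u₁).re
    = (Complex.exp (Complex.I * ((-u₂.re : ℝ) : ℂ)) * V u₂).re := by rw [hre, heq]
  refine Complex.ext hre ?_
  rcases lt_trichotomy u₁.im 0 with s₁ | s₁ | s₁ <;> rcases lt_trichotomy u₂.im 0 with s₂ | s₂ | s₂
  · by_contra hne
    have c₁ := hV.map_conj u₁ (by linarith)
    have c₂ := hV.map_conj u₂ (by linarith)
    have hc : V (starRingEnd ℂ u₁) = V (starRingEnd ℂ u₂) := by rw [c₁, c₂, heq]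
    rcases lt_or_gt_of_ne hne with hlt | hlt
    · exact hup _ _ (by simpa using h₂) (by simpa using h₁) (by simpa using hre.symm)
        (by simpa using s₂) (by simpa using hlt) hc.symm
    · exact hup _ _ (by simpa using h₁) (by simpa using h₂) (by simpa using hre)
        (by simpa using s₁) (by simpa using hlt) hc
  · linarith [hneg u₁ h₁' s₁, hzero u₂ h₂' s₂]
  · linarith [hneg u₁ h₁' s₁, hpos u₂ h₂' s₂]
  · linarith [hzero u₁ h₁' s₁, hneg u₂ h₂' s₂]
  · rw [s₁, s₂]
  · linarith [hzero u₁ h₁' s₁, hpos u₂ h₂' s₂]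
  · linarith [hpos u₁ h₁' s₁, hneg u₂ h₂' s₂]
  · linarith [hpos u₁ h₁' s₁, hzero u₂ h₂' s₂]
  · by_contra hne
    rcases lt_or_gt_of_ne hne with hlt | hlt
    · exact hup _ _ h₁ h₂ hre s₁ hlt heq
    · exact hup _ _ h₂ h₁ hre.symm s₂ hlt heq.symm

/-- The surface `(V u, Re u)` goes to infinity as `u` does. -/
theorem proper (hV : IsHelicoidal V R) (M : ℝ) :
    ∃ B ≥ R, ∀ u : ℂ, B < ‖u‖ → M < |u.re| + ‖V u‖ := by
  obtain ⟨B, hB, C, hsec⟩ := hV.sector one_pos le_rfl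
  have key : ∀ u : ℂ, max B (2 * |M| + 2 * |C| + |M|) < ‖u‖ → 0 ≤ u.im →
      M < |u.re| + ‖V u‖ := by
    intro u hu hy
    by_contra! hle
    have hu1 := (le_max_left _ _).trans_lt hu
    have hu2 := (le_max_right _ _).trans_lt hu
    have hn := Complex.norm_le_abs_re_add_abs_im u
    rw [abs_of_nonneg hy] at hn
    have hre := abs_nonneg u.re
    have hVn := norm_nonneg (V u)
    have hM := le_abs_self M
    have hC := le_abs_self C
    rcases hy.eq_or_lt with h0 | hpos
    · linarith [abs_nonneg M, abs_nonneg C]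
    · have h2 := (hsec u hu1 hpos).2
      have h3 : (Complex.exp (Complex.I * ((-u.re : ℝ) : ℂ)) * V u).re ≤ ‖V u‖ := by
        refine (Complex.re_le_norm _).trans ?_
        rw [norm_mul, norm_exp_I_mul, one_mul]
      linarith
  refine ⟨max B (2 * |M| + 2 * |C| + |M|), hB.trans (le_max_left _ _), fun u hu => ?_⟩
  rcases le_total 0 u.im with hy | hy
  · exact key u hu hy
  · have := key (starRingEnd ℂ u) (by simpa using hu) (by simpa using hy)
    rwa [hV.map_conj u (((hB.trans (le_max_left _ _))).trans_lt hu), norm_neg,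
      Complex.conj_re] at this

/-- Far out, `(V u, Re u)` has the same horizontal part as a point of the helicoid at nearly the
same height. -/
theorem exists_eq_mul_exp (hV : IsHelicoidal V R) {ε : ℝ} (hε : 0 < ε) :
    ∃ B ≥ R, ∀ u : ℂ, B < ‖u‖ →
      ∃ s t : ℝ, V u = s * Complex.exp (Complex.I * t) ∧ |u.re - t| ≤ ε := by
  obtain ⟨B, hB, C, hsec⟩ := hV.sector (ε := min ε 1) (by positivity) (min_le_right _ _)
  have key : ∀ u : ℂ, B < ‖u‖ → 0 ≤ u.im →
      ∃ s t : ℝ, V u = s * Complex.exp (Complex.I * t) ∧ |u.re - t| ≤ ε := by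
    intro u hu hy
    rcases hy.eq_or_lt with h0 | hpos
    · have hu' : u = (u.re : ℂ) := Complex.ext rfl (by simpa using h0.symm)
      have : V u = 0 := by
        rw [hu']
        refine hV.apply_ofReal ?_
        rw [hu', Complex.norm_real, Real.norm_eq_abs] at hu
        linarith
      exact ⟨0, u.re, by simp [this], by simpa using hε.le⟩
    · obtain ⟨h1, -⟩ := hsec u hu hpos
      set q := Complex.exp (Complex.I * ((-u.re : ℝ) : ℂ)) * V u with hq
      have hqre : 0 < q.re := by
        have := (abs_nonneg _).trans_lt h1
        exact pos_of_mul_pos_right this (by positivity)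
      refine ⟨‖q‖, u.re + q.arg, ?_, ?_⟩
      · have : V u = q * Complex.exp (Complex.I * u.re) := by
          rw [hq, mul_right_comm, ← Complex.exp_add]
          simp
        rw [this]
        conv_lhs => rw [← Complex.norm_mul_exp_arg_mul_I q]
        rw [mul_assoc, ← Complex.exp_add]
        congr 2
        push_cast
        ring
      · have harg : |q.arg| ≤ |q.im| / q.re := by
          have h2 : q.arg = Real.arctan (q.im / q.re) := by
            rw [← Complex.tan_arg, Real.arctan_tan] <;>
            · have := Complex.abs_arg_lt_pi_div_two_iff.2 (Or.inl hqre)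
              rw [abs_lt] at this
              linarith [this.1, this.2]
          rw [h2, ← abs_of_pos hqre, ← abs_div, abs_of_pos hqre]
          exact abs_arctan_le _
        rw [sub_add_cancel_left, abs_neg]
        refine harg.trans ?_
        rw [div_le_iff₀ hqre]
        exact h1.le.trans (by gcongr; exact min_le_left _ _)
  refine ⟨B, hB, fun u hu => ?_⟩
  rcases le_total 0 u.im with hy | hy
  · exact key u hu hy
  · obtain ⟨s, t, h1, h2⟩ := key (starRingEnd ℂ u) (by simpa using hu) (by simpa using hy)
    rw [hV.map_conj u (hB.trans_lt hu)] at h1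
    exact ⟨-s, t, by push_cast; linear_combination -h1, by simpa using h2⟩

/-- A point of a half-line of the helicoid is the value of `V` at a point over nearly the same
height, as soon as `V` is small enough at the starting heights `y₀`. -/
theorem exists_eq_mul_exp_of_start (hV : IsHelicoidal V R) {ε : ℝ} (hε : 0 < ε) (hε1 : ε ≤ 1 / 4) :
    ∃ B ≥ R, ∀ s t y₀ : ℝ, 0 < s → 0 ≤ y₀ →
      (∀ x ∈ Set.Icc (t - ε) (t + ε), ∀ y ≥ y₀, B < ‖(⟨x, y⟩ : ℂ)‖) →
      (∀ x ∈ Set.Icc (t - ε) (t + ε), ‖V ⟨x, y₀⟩‖ < s) →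
      ∃ u : ℂ, B < ‖u‖ ∧ V u = s * Complex.exp (Complex.I * t) ∧ |u.re - t| ≤ ε := by
  obtain ⟨B₁, hB₁, C, hsec⟩ := hV.sector (ε := ε / 2) (by positivity) (by linarith)
  obtain ⟨B₂, hB₂, hs⟩ := hV.slope (1 / 4) (by norm_num)
  refine ⟨max B₁ B₂, hB₁.trans (le_max_left _ _), fun s t y₀ hs0 hy₀ hB hstart => ?_⟩
  set a := Complex.exp (Complex.I * ((-t : ℝ) : ℂ)) with ha
  have hna : ‖a‖ = 1 := norm_exp_I_mul _
  have hder : ∀ x ∈ Set.Icc (t - ε) (t + ε), ∀ y ≥ y₀,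
      ∃ d ≥ 1 / 2, HasDerivAt (fun y : ℝ => (a * V ⟨x, y⟩).re) d y := by
    intro x hx y hy
    obtain ⟨c, θ, hc, hθ, hd⟩ := hs ⟨x, y⟩ ((le_max_right _ _).trans_lt (hB x hx y hy))
    refine ⟨_, ?_, hasDerivAt_re_mul (u := ⟨x, y⟩) a hd⟩
    rw [ha, ← Complex.exp_add]
    have : Complex.I * ((-t : ℝ) : ℂ) + Complex.I * ((x + θ : ℝ) : ℂ)
        = ((x - t + θ : ℝ) : ℂ) * Complex.I := by push_cast; ring
    simp only [this, Complex.exp_ofReal_mul_I_re]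
    have hcos : 1 - (x - t + θ) ^ 2 / 2 ≤ Real.cos (x - t + θ) := Real.one_sub_sq_div_two_le_cos
    have hθ2 : (x - t + θ) ^ 2 ≤ (1 / 2) ^ 2 := by
      rw [← sq_abs]
      gcongr
      refine abs_le.2 ⟨?_, ?_⟩ <;> linarith [hx.1, hx.2, (abs_le.1 hθ).1, (abs_le.1 hθ).2]
    nlinarith
  have hmono : ∀ x ∈ Set.Icc (t - ε) (t + ε),
      StrictMonoOn (fun y => (a * V ⟨x, y⟩).re) (Set.Ici y₀) := by
    intro x hx y₁ h₁ y₂ _ hlt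
    have := mul_sub_le_of_hasDerivAt_ge hlt.le fun y hy => hder x hx y (le_trans h₁ hy.1)
    simp only
    linarith
  have hroot : ∀ x ∈ Set.Icc (t - ε) (t + ε), ∃ y, y₀ < y ∧ (a * V ⟨x, y⟩).re = s := by
    intro x hx
    have h1 : |(a * V ⟨x, y₀⟩).re| < s := by
      refine (Complex.abs_re_le_norm _).trans_lt ?_
      rw [norm_mul, hna, one_mul]
      exact hstart x hx
    have h2 := mul_sub_le_of_hasDerivAt_ge (b := y₀ + 4 * s) (by linarith : y₀ ≤ y₀ + 4 * s)
      fun y hy => hder x hx y hy.1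
    have hc : ContinuousOn (fun y : ℝ => (a * V ⟨x, y⟩).re) (Set.Icc y₀ (y₀ + 4 * s)) := by
      intro y hy
      obtain ⟨d, -, hd⟩ := hder x hx y hy.1
      exact hd.continuousAt.continuousWithinAt
    have h3 := abs_lt.1 h1
    obtain ⟨y, hy, hy'⟩ := intermediate_value_Icc (by linarith) hc
      (⟨by linarith, by linarith⟩ : s ∈ Set.Icc _ _)
    refine ⟨y, hy.1.lt_of_ne fun h => ?_, hy'⟩
    rw [← h] at hy'
    simp only at hy'
    linarith
  choose! r hr using hroot
  have hcont : ∀ g : ℝ → ℝ, ContinuousOn g (Set.Icc (t - ε) (t + ε)) →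
      (∀ x ∈ Set.Icc (t - ε) (t + ε), y₀ ≤ g x) →
      ContinuousOn (fun x => V ⟨x, g x⟩) (Set.Icc (t - ε) (t + ε)) := by
    intro g hg hgy
    refine hV.continuousOn.comp (t := {u | R < ‖u‖}) ?_ fun x hx =>
      (hB₁.trans (le_max_left _ _)).trans_lt (hB x hx _ (hgy x hx))
    have : (fun x : ℝ => (⟨x, g x⟩ : ℂ)) = fun x : ℝ => (x : ℂ) + g x * Complex.I := by
      ext x : 1; exact Complex.mk_eq_add_mul_I x _
    rw [this]
    fun_prop
  have hrc : ContinuousOn r (Set.Icc (t - ε) (t + ε)) :=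
    continuousOn_of_strictMonoOn_root hmono (fun y hy => Complex.continuous_re.comp_continuousOn
      (continuousOn_const.mul (hcont (fun _ => y) continuousOn_const fun _ _ => hy))) hr
  have hkc : ContinuousOn (fun x => (a * V ⟨x, r x⟩).im) (Set.Icc (t - ε) (t + ε)) :=
    Complex.continuous_im.comp_continuousOn
      (continuousOn_const.mul (hcont r hrc fun x hx => (hr x hx).1.le))
  -- the sign of `Im (exp (-i t) V)` at the two ends of the interval of heights
  have hsin : ε / 2 ≤ Real.sin ε := by
    have := Real.sin_gt_sub_cube hε
    have h3 : ε ^ 3 ≤ ε * 1 := by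
      rw [pow_succ']; gcongr; exact pow_le_one₀ hε.le (by linarith)
    linarith
  have hend : ∀ x ∈ Set.Icc (t - ε) (t + ε), ∃ A D : ℝ, 0 < A ∧ |D| ≤ ε / 2 * A ∧
      (a * V ⟨x, r x⟩).im = Real.sin (x - t) * A + Real.cos (x - t) * D := by
    intro x hx
    have h1 := (hsec ⟨x, r x⟩ ((le_max_left _ _).trans_lt (hB x hx _ (hr x hx).1.le))
      (hy₀.trans_lt (hr x hx).1)).1
    set q := Complex.exp (Complex.I * ((-x : ℝ) : ℂ)) * V ⟨x, r x⟩ with hq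
    have e : a * V ⟨x, r x⟩ = Complex.exp (((x - t : ℝ) : ℂ) * Complex.I) * q := by
      rw [hq, ← mul_assoc, ← Complex.exp_add, ha]
      congr 2
      push_cast
      ring
    refine ⟨q.re, q.im, ?_, h1.le, ?_⟩
    · exact pos_of_mul_pos_right ((abs_nonneg _).trans_lt h1) (by positivity)
    · rw [e, Complex.mul_im, Complex.exp_ofReal_mul_I_re, Complex.exp_ofReal_mul_I_im]
      ring
  have hle : t - ε ≤ t + ε := by linarith
  have hlo : (a * V ⟨t - ε, r (t - ε)⟩).im ≤ 0 := by
    obtain ⟨A, D, hA, hD, e⟩ := hend _ (Set.left_mem_Icc.2 hle)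
    rw [e, sub_sub_cancel_left, Real.sin_neg, Real.cos_neg]
    have h1 : |Real.cos ε * D| ≤ 1 * (ε / 2 * A) := by
      rw [abs_mul]; gcongr; exact Real.abs_cos_le_one _
    nlinarith [(abs_le.1 h1).2]
  have hhi : 0 ≤ (a * V ⟨t + ε, r (t + ε)⟩).im := by
    obtain ⟨A, D, hA, hD, e⟩ := hend _ (Set.right_mem_Icc.2 hle)
    rw [e, add_sub_cancel_left]
    have h1 : |Real.cos ε * D| ≤ 1 * (ε / 2 * A) := by
      rw [abs_mul]; gcongr; exact Real.abs_cos_le_one _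
    nlinarith [(abs_le.1 h1).1]
  obtain ⟨x, hx, hx0⟩ := intermediate_value_Icc hle hkc ⟨hlo, hhi⟩
  refine ⟨⟨x, r x⟩, hB x hx _ (hr x hx).1.le, ?_, ?_⟩
  · have h1 : a * V ⟨x, r x⟩ = s := Complex.ext (by simpa using (hr x hx).2) (by simpa using hx0)
    have h2 : Complex.exp (Complex.I * t) * a = 1 := by
      rw [ha, ← Complex.exp_add]; simp
    calc V ⟨x, r x⟩ = Complex.exp (Complex.I * t) * a * V ⟨x, r x⟩ := by rw [h2, one_mul]
      _ = _ := by rw [mul_assoc, h1, mul_comm]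
  · exact abs_le.2 ⟨by simp only; linarith [hx.1], by simp only; linarith [hx.2]⟩

/-- Every point of the helicoid far out has the same horizontal part as a point `(V u, Re u)` at
nearly the same height. -/
theorem exists_of_far (hV : IsHelicoidal V R) {ε : ℝ} (hε : 0 < ε) (hε1 : ε ≤ 1 / 4) (B₀ : ℝ) :
    ∃ R' : ℝ, ∀ s t : ℝ, R' < |s| + |t| →
      ∃ u : ℂ, B₀ < ‖u‖ ∧ R < ‖u‖ ∧ V u = s * Complex.exp (Complex.I * t) ∧ |u.re - t| ≤ ε := by
  have hV' : IsHelicoidal V (max (max R B₀) 0) := by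
    have h0 : R ≤ max (max R B₀) 0 := (le_max_left _ _).trans (le_max_left _ _)
    refine ⟨hV.continuousOn.mono fun u hu => h0.trans_lt hu,
      fun u hu => hV.map_conj u (h0.trans_lt hu), fun ε hε => ?_⟩
    obtain ⟨B, hB, h⟩ := hV.slope ε hε
    exact ⟨max B (max (max R B₀) 0), le_max_right _ _,
      fun u hu => h u ((le_max_left _ _).trans_lt hu)⟩
  obtain ⟨B, hB, h⟩ := hV'.exists_eq_mul_exp_of_start hε hε1
  have hB0 : 0 ≤ B := (le_max_right _ _).trans hB
  have hBB : B₀ ≤ B := ((le_max_right _ _).trans (le_max_left _ _)).trans hB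
  have hBR : R ≤ B := ((le_max_left _ _).trans (le_max_left _ _)).trans hB
  obtain ⟨M, hM0, hM⟩ := hV.exists_bound (B + 3) (y := B + 1)
    (by rw [abs_of_pos (by linarith)]; linarith)
  have key : ∀ s t : ℝ, B + 2 + M < |s| + |t| → 0 ≤ s →
      ∃ u : ℂ, B < ‖u‖ ∧ V u = s * Complex.exp (Complex.I * t) ∧ |u.re - t| ≤ ε := by
    intro s t hst hs
    rcases hs.eq_or_lt with rfl | hs
    · rw [abs_zero, zero_add] at hst
      refine ⟨t, ?_, ?_, by simpa using hε.le⟩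
      · rw [Complex.norm_real, Real.norm_eq_abs]; linarith
      · rw [hV.apply_ofReal (by linarith)]; simp
    · have hxt : ∀ x ∈ Set.Icc (t - ε) (t + ε), |x - t| ≤ 1 / 4 := fun x hx =>
        abs_le.2 ⟨by linarith [hx.1], by linarith [hx.2]⟩
      by_cases ht : B + 1 < |t|
      · have hx : ∀ x ∈ Set.Icc (t - ε) (t + ε), B < |x| := by
          intro x hx
          have := abs_sub_abs_le_abs_sub t x
          rw [abs_sub_comm] at this
          linarith [hxt x hx]
        refine h s t 0 hs le_rfl (fun x hx' y _ => le_norm_mk (Or.inl (hx x hx')))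
          fun x hx' => ?_
        have : V ⟨x, 0⟩ = 0 := hV.apply_ofReal (by linarith [hx x hx'])
        rw [this, norm_zero]
        exact hs
      · push Not at ht
        rw [abs_of_pos hs] at hst
        refine h s t (B + 1) hs (by linarith) (fun x _ y hy => le_norm_mk (Or.inr ?_))
          fun x hx => (hM x ?_).trans_lt (by linarith)
        · linarith [le_abs_self y]
        · have := abs_sub_abs_le_abs_sub x t
          linarith [hxt x hx]
  refine ⟨B + 2 + M, fun s t hst => ?_⟩
  rcases le_total 0 s with hs | hs
  · obtain ⟨u, h1, h2, h3⟩ := key s t hst hs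
    exact ⟨u, by linarith, by linarith, h2, h3⟩
  · obtain ⟨u, h1, h2, h3⟩ := key (-s) t (by rwa [abs_neg]) (by linarith)
    refine ⟨starRingEnd ℂ u, by simp; linarith, by simp; linarith, ?_, by simpa using h3⟩
    rw [hV.map_conj u (by linarith), h2]
    push_cast
    ring

end IsHelicoidal

/-! ### The Weierstrass representation, pointwise -/

/-- The real differential `v ↦ (conj (ω v / g) - g ω v) / 2` of `x₁ + i x₂` at a point where the Gauss
map is `g` and `dh = ω dz`. -/
def weierstrassD (g ω : ℂ) : ℂ →L[ℝ] ℂ :=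
  (2⁻¹ : ℂ) • ((Complex.conjCLE : ℂ →L[ℝ] ℂ).comp
    (ContinuousLinearMap.mul ℝ ℂ (ω / g)) - ContinuousLinearMap.mul ℝ ℂ (g * ω))

theorem weierstrassD_apply (g ω v : ℂ) :
    weierstrassD g ω v = (starRingEnd ℂ (ω / g * v) - g * ω * v) / 2 := by
  simp only [weierstrassD, smul_apply, sub_apply,
    ContinuousLinearMap.comp_apply, ContinuousLinearMap.mul_apply', smul_eq_mul,
    ContinuousLinearEquiv.coe_coe, Complex.conjCLE_apply]
  ring

/-- If `a, b` are orthogonal of the same length, with unit normal `N`, and `φ = a - i b`, then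
`(N₁ + i N₂) (φ₁ - i φ₂) = (1 - N₃) φ₃`; here this is multiplied by `|a × b| = l`. -/
theorem gauss_mul_eq (a₀ a₁ a₂ b₀ b₁ b₂ l : ℝ) (haa : a₀ ^ 2 + a₁ ^ 2 + a₂ ^ 2 = l)
    (hbb : b₀ ^ 2 + b₁ ^ 2 + b₂ ^ 2 = l) (hab : a₀ * b₀ + a₁ * b₁ + a₂ * b₂ = 0) :
    (((a₁ * b₂ - a₂ * b₁ : ℝ) : ℂ) + Complex.I * ((a₂ * b₀ - a₀ * b₂ : ℝ) : ℂ)) *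
      (((a₀ : ℂ) - Complex.I * b₀) - Complex.I * ((a₁ : ℂ) - Complex.I * b₁)) =
    ((l : ℂ) - ((a₀ * b₁ - a₁ * b₀ : ℝ) : ℂ)) * ((a₂ : ℂ) - Complex.I * b₂) := by
  apply Complex.ext
  · simp
    linear_combination a₂ * hbb - b₂ * hab
  · simp
    linear_combination -b₂ * haa + a₂ * hab

/-- For a conformal map the two partial derivatives are orthogonal and have the same length. -/
theorem conformalAt_partialD {X : ℂ → E3} {z : ℂ} (hX : ConformalAt X z) :
    ∃ l > 0, (partialD X 1 z 0) ^ 2 + (partialD X 1 z 1) ^ 2 + (partialD X 1 z 2) ^ 2 = l ∧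
      (partialD X Complex.I z 0) ^ 2 + (partialD X Complex.I z 1) ^ 2
        + (partialD X Complex.I z 2) ^ 2 = l ∧
      partialD X 1 z 0 * partialD X Complex.I z 0 + partialD X 1 z 1 * partialD X Complex.I z 1
        + partialD X 1 z 2 * partialD X Complex.I z 2 = 0 := by
  obtain ⟨f', hf, c, hc, li, rfl⟩ := hX
  have hp : ∀ v, partialD X v z = c • li v := fun v => by
    rw [partialD, hf.fderiv]; rfl
  have hn : ∀ v w : ℂ, partialD X v z 0 * partialD X w z 0 + partialD X v z 1 * partialD X w z 1
      + partialD X v z 2 * partialD X w z 2 = c ^ 2 * inner ℝ v w := by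
    intro v w
    have h : inner ℝ (partialD X v z) (partialD X w z) = c ^ 2 * inner ℝ v w := by
      rw [hp, hp, inner_smul_left, inner_smul_right, li.inner_map_map]
      simp only [conj_trivial]
      ring
    rw [← h, PiLp.inner_apply, Fin.sum_univ_three]
    simp only [RCLike.inner_apply, conj_trivial]
    ring
  have h1 := hn 1 1
  have h2 := hn Complex.I Complex.I
  have h3 := hn 1 Complex.I
  simp [Complex.inner] at h1 h2 h3
  refine ⟨c ^ 2, by positivity, ?_, ?_, ?_⟩ <;> linarith

/-- The relation `g (φ₁ - i φ₂) = φ₃` between the Gauss map and the forms `φ = (X_x - i X_y) dz`. -/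
theorem gaussMap_mul {X : ℂ → E3} {z : ℂ} (hX : ConformalAt X z) (hg : gaussMap X z ≠ 0) :
    gaussMap X z * (((partialD X 1 z 0 : ℂ) - Complex.I * partialD X Complex.I z 0)
      - Complex.I * ((partialD X 1 z 1 : ℂ) - Complex.I * partialD X Complex.I z 1)) =
    heightForm X z := by
  obtain ⟨l, hl, haa, hbb, hab⟩ := conformalAt_partialD hX
  have key := gauss_mul_eq _ _ _ _ _ _ l haa hbb hab
  set a := partialD X 1 z with ha
  set b := partialD X Complex.I z with hb
  set n : E3 := WithLp.toLp 2 (WithLp.ofLp a ⨯₃ WithLp.ofLp b) with hn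
  have n0 : n 0 = a 1 * b 2 - a 2 * b 1 := by simp [hn, cross_apply]
  have n1 : n 1 = a 2 * b 0 - a 0 * b 2 := by simp [hn, cross_apply]
  have n2 : n 2 = a 0 * b 1 - a 1 * b 0 := by simp [hn, cross_apply]
  have hnorm : ‖n‖ = l := by
    rw [EuclideanSpace.norm_eq, Fin.sum_univ_three, Real.norm_eq_abs, Real.norm_eq_abs,
      Real.norm_eq_abs, sq_abs, sq_abs, sq_abs, n0, n1, n2, Real.sqrt_eq_iff_mul_self_eq_of_pos hl]
    -- Lagrange's identity
    linear_combination -l * hbb - (b 0 ^ 2 + b 1 ^ 2 + b 2 ^ 2) * haa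
      + (a 0 * b 0 + a 1 * b 1 + a 2 * b 2) * hab
  have hN : unitNormal X z = l⁻¹ • n := by
    rw [← hnorm]; rfl
  have hl' : (l : ℂ) ≠ 0 := Complex.ofReal_ne_zero.2 hl.ne'
  have hgd : gaussMap X z = ((n 0 : ℂ) + Complex.I * n 1) / ((l : ℂ) - n 2) := by
    rw [gaussMap, hN]
    simp only [PiLp.smul_apply, smul_eq_mul]
    push_cast
    rw [← mul_div_mul_left _ _ hl']
    congr 1 <;> field_simp
  have hden : (l : ℂ) - n 2 ≠ 0 := fun h => hg (by rw [hgd, h, div_zero])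
  rw [hgd, div_mul_eq_mul_div, div_eq_iff hden, n0, n1, key, ← n2]
  rw [heightForm, mul_comm]

/-- The Weierstrass representation of the horizontal part `x₁ + i x₂` of the differential. -/
theorem hasFDerivAt_horizontal {X : ℂ → E3} {z : ℂ} (hX : ConformalAt X z)
    (hg : gaussMap X z ≠ 0) (hh : heightForm X z ≠ 0) :
    HasFDerivAt (fun z => (X z 0 : ℂ) + Complex.I * X z 1)
      (weierstrassD (gaussMap X z) (heightForm X z)) z := by
  have hd : HasFDerivAt X (fderiv ℝ X z) z := hX.differentiableAt.hasFDerivAt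
  have hc : ∀ i : Fin 3, HasFDerivAt (fun z => (X z i : ℂ))
      (Complex.ofRealCLM.comp ((EuclideanSpace.proj (𝕜 := ℝ) i).comp (fderiv ℝ X z))) z := fun i =>
    Complex.ofRealCLM.hasFDerivAt.comp z ((EuclideanSpace.proj (𝕜 := ℝ) i).hasFDerivAt.comp z hd)
  refine ((hc 0).add ((hc 1).const_mul Complex.I)).congr_fderiv ?_
  have h1 := gaussMap_mul hX hg
  obtain ⟨l, hl, haa, hbb, hab⟩ := conformalAt_partialD hX
  set g := gaussMap X z with hgdef
  set ω := heightForm X z with hω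
  have hwd : (partialD X 1 z 2 : ℂ) - Complex.I * partialD X Complex.I z 2 = ω := rfl
  have e1 : fderiv ℝ X z 1 = partialD X 1 z := rfl
  have e2 : fderiv ℝ X z Complex.I = partialD X Complex.I z := rfl
  set a := partialD X 1 z with ha
  set b := partialD X Complex.I z with hb
  -- `φ₁² + φ₂² + φ₃² = 0`
  have hsq : ((a 0 : ℂ) - Complex.I * b 0) ^ 2 + ((a 1 : ℂ) - Complex.I * b 1) ^ 2
      + ((a 2 : ℂ) - Complex.I * b 2) ^ 2 = 0 := by
    have h1' : ((a 0 : ℂ)) ^ 2 + (a 1 : ℂ) ^ 2 + (a 2 : ℂ) ^ 2 = l := by exact_mod_cast haa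
    have h2' : ((b 0 : ℂ)) ^ 2 + (b 1 : ℂ) ^ 2 + (b 2 : ℂ) ^ 2 = l := by exact_mod_cast hbb
    have h3' : (a 0 : ℂ) * b 0 + a 1 * b 1 + a 2 * b 2 = 0 := by
      rw [← Complex.ofReal_zero, ← hab]; push_cast; rfl
    linear_combination h1' + Complex.I ^ 2 * h2' - 2 * Complex.I * h3' + l * Complex.I_sq
  have hM : ((a 0 : ℂ) - Complex.I * b 0) - Complex.I * ((a 1 : ℂ) - Complex.I * b 1) = ω / g := by
    rw [eq_div_iff hg, mul_comm]; exact h1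
  have hP : ((a 0 : ℂ) - Complex.I * b 0) + Complex.I * ((a 1 : ℂ) - Complex.I * b 1) =
      -(g * ω) := by
    have : (((a 0 : ℂ) - Complex.I * b 0) + Complex.I * ((a 1 : ℂ) - Complex.I * b 1)) * (ω / g) =
        -(g * ω) * (ω / g) := by
      rw [← hM]
      have : -(g * ω) * (((a 0 : ℂ) - Complex.I * b 0) - Complex.I * ((a 1 : ℂ) - Complex.I * b 1))
        = -ω * ω := by rw [hM]; field_simp
      rw [this, ← hwd]
      linear_combination hsq - ((a 1 : ℂ) - Complex.I * b 1) ^ 2 * Complex.I_sq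
    exact mul_right_cancel₀ (div_ne_zero hh hg) this
  have hMc : ((a 0 : ℂ) + Complex.I * b 0) + Complex.I * ((a 1 : ℂ) + Complex.I * b 1) =
      starRingEnd ℂ (ω / g) := by
    rw [← hM]
    simp only [map_sub, map_mul, Complex.conj_ofReal, Complex.conj_I]
    ring
  ext v
  have hv : fderiv ℝ X z v = v.re • a + v.im • b := by
    conv_lhs => rw [← Complex.re_add_im v]
    have : (v.re : ℂ) + v.im * Complex.I = v.re • (1 : ℂ) + v.im • Complex.I := by simp
    rw [this, map_add, map_smul, map_smul, e1, e2]
  have hvv : v = v.re + v.im * Complex.I := (Complex.re_add_im v).symm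
  have hvc : starRingEnd ℂ v = v.re - v.im * Complex.I := by
    apply Complex.ext <;> simp
  have hP' : g * ω = -(((a 0 : ℂ) - Complex.I * b 0)
      + Complex.I * ((a 1 : ℂ) - Complex.I * b 1)) := by rw [hP, neg_neg]
  rw [weierstrassD_apply, map_mul, ← hMc, hP', hvc]
  simp only [add_apply, smul_apply, ContinuousLinearMap.comp_apply, hv, Complex.ofRealCLM_apply,
    PiLp.proj_apply, PiLp.add_apply, PiLp.smul_apply, smul_eq_mul]
  push_cast
  conv_rhs => rw [hvv]
  apply Complex.ext <;> simp <;> ring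

theorem hasFDerivAt_height {X : ℂ → E3} {z : ℂ} (hX : ConformalAt X z) :
    HasFDerivAt (fun z => X z 2)
      (Complex.reCLM.comp (ContinuousLinearMap.mul ℝ ℂ (heightForm X z))) z := by
  have hd : HasFDerivAt X (fderiv ℝ X z) z := hX.differentiableAt.hasFDerivAt
  refine ((EuclideanSpace.proj (𝕜 := ℝ) (2 : Fin 3)).hasFDerivAt.comp z hd).congr_fderiv ?_
  ext v
  have hv : fderiv ℝ X z v = v.re • partialD X 1 z + v.im • partialD X Complex.I z := by
    conv_lhs => rw [← Complex.re_add_im v]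
    have : (v.re : ℂ) + v.im * Complex.I = v.re • (1 : ℂ) + v.im • Complex.I := by simp
    rw [this, map_add, map_smul, map_smul, partialD, partialD]
  simp only [ContinuousLinearMap.comp_apply, hv, PiLp.proj_apply, PiLp.add_apply,
    PiLp.smul_apply, smul_eq_mul, ContinuousLinearMap.mul_apply', Complex.reCLM_apply, heightForm]
  simp
  ring

/-! ### The height function as a coordinate at infinity -/

theorem exp_image_preimage_norm {S : Set ℝ} (hS : ∀ r ∈ S, 0 < r) :
    Complex.exp '' {w | Real.exp w.re ∈ S} = {z | ‖z‖ ∈ S} := by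
  ext z
  constructor
  · rintro ⟨w, hw, rfl⟩
    rwa [Set.mem_ofPred_eq, Complex.norm_exp]
  · intro hz
    have hz0 : z ≠ 0 := norm_pos_iff.1 (hS _ hz)
    refine ⟨Complex.log z, ?_, Complex.exp_log hz0⟩
    rwa [Set.mem_ofPred_eq, Complex.log_re, Real.exp_log (norm_pos_iff.2 hz0)]

/-- Annuli around `0`, being images of strips under `exp`, are connected. -/
theorem isPreconnected_setOf_norm_mem {S : Set ℝ} (hS : ∀ r ∈ S, 0 < r) (hc : S.OrdConnected) :
    IsPreconnected {z : ℂ | ‖z‖ ∈ S} := by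
  rw [← exp_image_preimage_norm hS]
  have h : ((fun x : ℝ => Real.exp x) ⁻¹' S).OrdConnected := hc.preimage_mono Real.exp_monotone
  exact ((h.convex.linear_preimage Complex.reLm).isPreconnected).image _
    Complex.continuous_exp.continuousOn

theorem isPreconnected_puncturedBall (ρ : ℝ) : IsPreconnected {z : ℂ | 0 < ‖z‖ ∧ ‖z‖ < ρ} :=
  isPreconnected_setOf_norm_mem (S := Set.Ioo 0 ρ) (fun _ h => h.1) Set.ordConnected_Ioo

theorem isPreconnected_norm_gt {R : ℝ} (hR : 0 ≤ R) : IsPreconnected {z : ℂ | R < ‖z‖} :=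
  isPreconnected_setOf_norm_mem (S := Set.Ioi R) (fun _ h => hR.trans_lt h) Set.ordConnected_Ioi

theorem isOpen_norm_gt (R : ℝ) : IsOpen {z : ℂ | R < ‖z‖} :=
  isOpen_lt continuous_const continuous_norm

theorem exists_forall_norm_gt {p : ℂ → Prop} (h : ∀ᶠ u in Bornology.cobounded ℂ, p u) :
    ∃ R > 0, ∀ u, R < ‖u‖ → p u := by
  obtain ⟨R, -, hR⟩ := hasBasis_cobounded_norm.eventually_iff.1 h
  exact ⟨max R 1, by positivity, fun u hu => hR ((le_max_left _ _).trans hu.le)⟩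

theorem exists_forall_norm_lt {p : ℂ → Prop} (h : ∀ᶠ z in 𝓝 0, p z) :
    ∃ ρ > 0, ∀ z, ‖z‖ < ρ → p z := by
  obtain ⟨ρ, h0, hρ⟩ := Metric.eventually_nhds_iff.1 h
  exact ⟨ρ, h0, fun z hz => hρ (by simpa using hz)⟩

theorem tendsto_inv_cobounded_nhdsNE : Tendsto Inv.inv (Bornology.cobounded ℂ) (𝓝[≠] 0) := by
  refine tendsto_nhdsWithin_iff.2 ⟨tendsto_inv₀_cobounded, ?_⟩
  filter_upwards [(hasBasis_cobounded_norm (E := ℂ)).mem_of_mem (i := 1) trivial] with u hu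
  have : u ≠ 0 := by
    rintro rfl
    simp at hu
    linarith
  simpa using this

/-- A form `b z / z² dz` with holomorphic `b` and without residue has a primitive. -/
theorem exists_primitive {b : ℂ → ℂ} {ρ : ℝ} (hρ : 0 < ρ)
    (hb : DifferentiableOn ℂ b (Metric.ball 0 ρ)) (hb' : deriv b 0 = 0) :
    ∃ C : ℂ → ℂ, DifferentiableOn ℂ C (Metric.ball 0 ρ) ∧
      ∀ z ∈ Metric.ball (0 : ℂ) ρ, z ≠ 0 →
        HasDerivAt (fun z => -b 0 / z + C z) (b z / z ^ 2) z := by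
  have hn := Metric.ball_mem_nhds (0 : ℂ) hρ
  have h2 : DifferentiableOn ℂ (dslope (dslope b 0) 0) (Metric.ball 0 ρ) :=
    (Complex.differentiableOn_dslope hn).2 ((Complex.differentiableOn_dslope hn).2 hb)
  obtain ⟨C, hC⟩ := h2.isExactOn_ball
  refine ⟨C, fun z hz => (hC z hz).differentiableAt.differentiableWithinAt, fun z hz hz0 => ?_⟩
  have e1 : z * dslope b 0 z = b z - b 0 := by simpa using sub_smul_dslope b 0 z
  have e2 : z * dslope (dslope b 0) 0 z = dslope b 0 z := by
    simpa [dslope_same, hb'] using sub_smul_dslope (dslope b 0) 0 z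
  have h := ((hasDerivAt_inv hz0).const_mul (-b 0)).add (hC z hz)
  refine (h.congr_of_eventuallyEq (Eventually.of_forall fun w => ?_)).congr_deriv ?_
  · simp [div_eq_mul_inv]
  · field_simp
    linear_combination z * e2 + e1

/-- The residue of `b z / z² dz` is the derivative of `b` at `0`. -/
theorem deriv_eq_zero_of_hasNoResidue {ω b : ℂ → ℂ} {ρ : ℝ} (hρ : 0 < ρ)
    (hb : DifferentiableOn ℂ b (Metric.ball 0 ρ))
    (hω : ∀ z, 0 < ‖z‖ → ‖z‖ < ρ → ω z = b z / z ^ 2) (hres : HasNoResidue ω) :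
    deriv b 0 = 0 := by
  have hev : ∀ᶠ r in 𝓝[>] (0 : ℝ), r < ρ ∧ 0 < r :=
    ((eventually_lt_nhds hρ).filter_mono nhdsWithin_le_nhds).and self_mem_nhdsWithin
  obtain ⟨r, hr, hrρ, hr0⟩ := (hres.and hev).exists
  have h := Complex.two_pi_I_inv_smul_circleIntegral_sub_sq_inv_smul_of_differentiable
    Metric.isOpen_ball (Metric.closedBall_subset_ball hrρ) hb (Metric.mem_ball_self hr0)
  rw [← h, ← circleIntegral.integral_congr hr0.le, hr, smul_zero]
  intro z hz
  have hz' : ‖z‖ = r := by simpa using hz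
  simp only [hω z (by rw [hz']; exact hr0) (by rw [hz']; exact hrρ), sub_zero, smul_eq_mul]
  rw [div_eq_inv_mul]

/-- Weierstrass data on the neighbourhood `{R < |u|}` of infinity, in a coordinate with `dh = du`:
`G` is the Gauss map, whose logarithmic derivative `L (1 / u)` extends holomorphically to `u = ∞`
with a nonzero value, and `W` is the horizontal projection `x₁ + i x₂` of the surface. -/
structure IsEndData (R : ℝ) (W G L : ℂ → ℂ) : Prop where
  pos : 0 < R
  analytic : AnalyticOnNhd ℂ L (Metric.ball 0 R⁻¹)
  ne_zero : L 0 ≠ 0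
  gauss_ne_zero : ∀ u, R < ‖u‖ → G u ≠ 0
  gauss_deriv : ∀ u, R < ‖u‖ → HasDerivAt G (L u⁻¹ * G u) u
  hasFDerivAt : ∀ u, R < ‖u‖ → HasFDerivAt W (weierstrassD (G u) 1) u

/-- The map `ψ`, with inverse `θ`, reparametrises the end `X` near the puncture by a neighbourhood
`{R < |u|}` of infinity, in such a way that the height is `Re u`; `W` is `x₁ + i x₂` in this
coordinate. -/
structure IsEndChart (X : ℂ → E3) (R : ℝ) (ψ θ W : ℂ → ℂ) : Prop where
  tendsto_param : Tendsto ψ (Bornology.cobounded ℂ) (𝓝[≠] 0)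
  tendsto_coord : Tendsto θ (𝓝[≠] 0) (Bornology.cobounded ℂ)
  left_inv : ∀ᶠ z in 𝓝[≠] 0, ψ (θ z) = z
  horizontal : ∀ u, R < ‖u‖ → (X (ψ u) 0 : ℂ) + Complex.I * X (ψ u) 1 = W u
  height : ∀ u, R < ‖u‖ → X (ψ u) 2 = u.re

/-- The height function together with a harmonic conjugate is a coordinate at infinity. -/
theorem exists_heightCoordinate {X : ℂ → E3} {b : ℂ → ℂ} {ρ : ℝ} (hρ : 0 < ρ)
    (hX : ∀ z, 0 < ‖z‖ → ‖z‖ < ρ → ConformalAt X z)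
    (hb : DifferentiableOn ℂ b (Metric.ball 0 ρ)) (hb0 : b 0 ≠ 0) (hb' : deriv b 0 = 0)
    (hω : ∀ z, 0 < ‖z‖ → ‖z‖ < ρ → heightForm X z = b z / z ^ 2) :
    ∃ h ζ : ℂ → ℂ, (∀ z, 0 < ‖z‖ → ‖z‖ < ρ → HasDerivAt h (heightForm X z) z ∧ X z 2 = (h z).re) ∧
      AnalyticAt ℂ ζ 0 ∧ ζ 0 = 0 ∧ deriv ζ 0 ≠ 0 ∧ ∀ z, h z = (ζ z)⁻¹ := by
  obtain ⟨C, hC, hCd⟩ := exists_primitive hρ hb hb'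
  set h₀ : ℂ → ℂ := fun z => -b 0 / z + C z with hh₀
  have hd0 : ∀ z, 0 < ‖z‖ → ‖z‖ < ρ → HasDerivAt h₀ (heightForm X z) z := fun z h1 h2 => by
    rw [hω z h1 h2]
    exact hCd z (by simpa using h2) (norm_pos_iff.1 h1)
  have hopen : IsOpen {z : ℂ | 0 < ‖z‖ ∧ ‖z‖ < ρ} :=
    (isOpen_lt continuous_const continuous_norm).inter (isOpen_lt continuous_norm continuous_const)
  have hzero : ∀ z ∈ {z : ℂ | 0 < ‖z‖ ∧ ‖z‖ < ρ},
      HasFDerivAt (fun z => X z 2 - (h₀ z).re) (0 : ℂ →L[ℝ] ℝ) z := by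
    intro z hz
    have h1 := hasFDerivAt_height (hX z hz.1 hz.2)
    have h2 := Complex.reCLM.hasFDerivAt.comp z
      ((hd0 z hz.1 hz.2).hasFDerivAt.restrictScalars ℝ)
    refine (h1.sub h2).congr_fderiv ?_
    ext v
    simp [mul_comm]
  obtain ⟨k, hk⟩ := hopen.exists_is_const_of_fderiv_eq_zero (𝕜 := ℝ) (isPreconnected_puncturedBall ρ)
    (fun z hz => (hzero z hz).differentiableAt.differentiableWithinAt)
    (fun z hz => (hzero z hz).fderiv)
  have hden : -b 0 + 0 * (C 0 + k) ≠ 0 := by simpa using hb0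
  have hCa : AnalyticAt ℂ C 0 := hC.analyticAt (Metric.ball_mem_nhds _ hρ)
  have hDa : AnalyticAt ℂ (fun z => -b 0 + z * (C z + k)) 0 :=
    analyticAt_const.add (analyticAt_id.mul (hCa.add analyticAt_const))
  have hζa : AnalyticAt ℂ (fun z => z / (-b 0 + z * (C z + k))) 0 := analyticAt_id.div hDa hden
  refine ⟨fun z => (z / (-b 0 + z * (C z + k)))⁻¹, fun z => z / (-b 0 + z * (C z + k)),
    fun z h1 h2 => ?_, hζa, by simp, ?_, fun z => rfl⟩
  · have hz0 : z ≠ 0 := norm_pos_iff.1 h1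
    have e : ∀ w : ℂ, w ≠ 0 → (w / (-b 0 + w * (C w + k)))⁻¹ = h₀ w + k := fun w hw => by
      rw [inv_div, hh₀]
      field_simp
      ring
    constructor
    · refine ((hd0 z h1 h2).add_const (k : ℂ)).congr_of_eventuallyEq ?_
      filter_upwards [isOpen_ne.mem_nhds hz0] with w hw using e w hw
    · beta_reduce
      rw [e z hz0]
      have := hk z ⟨h1, h2⟩
      simp only [Complex.add_re, Complex.ofReal_re]
      linarith
  · have hd : HasDerivAt (fun z => z / (-b 0 + z * (C z + k))) (-b 0)⁻¹ 0 := by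
      refine ((hasDerivAt_id (0 : ℂ)).div hDa.differentiableAt.hasDerivAt hden).congr_deriv ?_
      simp
      field_simp
    rw [hd.deriv]
    exact inv_ne_zero (neg_ne_zero.2 hb0)

theorem exists_analytic_of_hasDoublePole {ω : ℂ → ℂ} (h : HasDoublePole ω) :
    ∃ a : ℂ → ℂ, AnalyticAt ℂ a 0 ∧ a 0 ≠ 0 ∧ ∀ᶠ z in 𝓝[≠] 0, ω z = a z / z ^ 2 := by
  have hm : MeromorphicAt ω 0 := by
    by_contra hm
    have := meromorphicOrderAt_of_not_meromorphicAt hm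
    rw [HasDoublePole, this] at h
    exact absurd h (by decide)
  obtain ⟨a, ha, ha0, hev⟩ := (meromorphicOrderAt_eq_int_iff hm).1 h
  refine ⟨a, ha, ha0, hev.mono fun z hz => ?_⟩
  rw [hz, sub_zero, smul_eq_mul, div_eq_mul_inv, mul_comm]
  rfl

/-- The end in the coordinate `u = ∫ dh`, with its Weierstrass data. -/
theorem exists_endChart {X : ℂ → E3} (hX : ∀ᶠ z in 𝓝[≠] 0, ConformalAt X z)
    (hg : HasDoublePole (logDeriv (gaussMap X))) (hh : HasDoublePole (heightForm X))
    (hres : HasNoResidue (heightForm X)) :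
    ∃ (R : ℝ) (ψ θ W G L : ℂ → ℂ), IsEndChart X R ψ θ W ∧ IsEndData R W G L := by
  obtain ⟨a, ha, ha0, hae⟩ := exists_analytic_of_hasDoublePole hg
  obtain ⟨b, hb, hb0, hbe⟩ := exists_analytic_of_hasDoublePole hh
  have hev : ∀ᶠ z in 𝓝 (0 : ℂ), (AnalyticAt ℂ b z ∧ a z ≠ 0 ∧ b z ≠ 0) ∧
      (z ∈ ({0}ᶜ : Set ℂ) → (ConformalAt X z ∧ logDeriv (gaussMap X) z = a z / z ^ 2) ∧
        heightForm X z = b z / z ^ 2) :=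
    (hb.eventually_analyticAt.and ((ha.continuousAt.eventually_ne ha0).and
      (hb.continuousAt.eventually_ne hb0))).and
      (eventually_nhdsWithin_iff.1 ((hX.and hae).and hbe))
  obtain ⟨ρ, hρ, hP⟩ := exists_forall_norm_lt hev
  have hPz : ∀ z, 0 < ‖z‖ → ‖z‖ < ρ → (ConformalAt X z ∧ logDeriv (gaussMap X) z = a z / z ^ 2) ∧
        heightForm X z = b z / z ^ 2 := fun z h1 h2 => (hP z h2).2 (norm_pos_iff.1 h1)
  have hbd : DifferentiableOn ℂ b (Metric.ball 0 ρ) := fun z hz =>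
    (hP z (by simpa using hz)).1.1.differentiableAt.differentiableWithinAt
  have hb' := deriv_eq_zero_of_hasNoResidue hρ hbd (fun z h1 h2 => (hPz z h1 h2).2) hres
  obtain ⟨h, ζ, hhd, hζa, hζ0, hζd, hhζ⟩ := exists_heightCoordinate hρ
    (fun z h1 h2 => (hPz z h1 h2).1.1) hbd hb0 hb' (fun z h1 h2 => (hPz z h1 h2).2)
  set η := HasStrictDerivAt.localInverse ζ (deriv ζ 0) 0 hζa.hasStrictDerivAt hζd with hη
  have hηa : AnalyticAt ℂ η 0 := by
    have := hζa.analyticAt_localInverse hζd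
    rwa [hζ0] at this
  have hηd : HasDerivAt η (deriv ζ 0)⁻¹ 0 := by
    have := (hζa.hasStrictDerivAt.to_localInverse hζd).hasDerivAt
    rwa [hζ0] at this
  have hleft : ∀ᶠ z in 𝓝 0, η (ζ z) = z := hζa.hasStrictDerivAt.eventually_left_inverse hζd
  have hright : ∀ᶠ w in 𝓝 0, ζ (η w) = w := by
    have := hζa.hasStrictDerivAt.eventually_right_inverse hζd
    rwa [hζ0] at this
  have hη0 : η 0 = 0 := by
    have := hleft.self_of_nhds
    rwa [hζ0] at this
  set ψ : ℂ → ℂ := fun u => η u⁻¹ with hψ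
  have hψt : Tendsto ψ (Bornology.cobounded ℂ) (𝓝[≠] 0) := by
    have := hηd.tendsto_nhdsNE (inv_ne_zero hζd)
    rw [hη0] at this
    exact this.comp tendsto_inv_cobounded_nhdsNE
  have hht : Tendsto h (𝓝[≠] 0) (Bornology.cobounded ℂ) := by
    have := hζa.differentiableAt.hasDerivAt.tendsto_nhdsNE hζd
    rw [hζ0] at this
    exact (tendsto_inv₀_nhdsNE_zero.comp this).congr fun z => (hhζ z).symm
  set L : ℂ → ℂ := fun w => a (η w) / b (η w) with hL
  have haη : AnalyticAt ℂ (fun w => a (η w)) 0 := by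
    rw [← hη0] at ha
    exact ha.comp hηa
  have hbη : AnalyticAt ℂ (fun w => b (η w)) 0 := by
    rw [← hη0] at hb
    exact hb.comp hηa
  have hLa : AnalyticAt ℂ L 0 := haη.div hbη (by rw [hη0]; exact hb0)
  obtain ⟨δ, hδ, hLδ⟩ := exists_forall_norm_lt hLa.eventually_analyticAt
  have hψP : ∀ᶠ u in Bornology.cobounded ℂ, (0 < ‖ψ u‖ ∧ ‖ψ u‖ < ρ) ∧ ψ u ∈ ({0}ᶜ : Set ℂ) := by
    have h1 : ∀ᶠ z in 𝓝[≠] (0 : ℂ), (0 < ‖z‖ ∧ ‖z‖ < ρ) ∧ z ∈ ({0}ᶜ : Set ℂ) := by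
      filter_upwards [self_mem_nhdsWithin, nhdsWithin_le_nhds (Metric.ball_mem_nhds (0 : ℂ) hρ)]
        with z h1 h2
      exact ⟨⟨norm_pos_iff.2 h1, by simpa using h2⟩, h1⟩
    exact hψt.eventually h1
  have hinvt : Tendsto (Inv.inv : ℂ → ℂ) (Bornology.cobounded ℂ) (𝓝 0) := tendsto_inv₀_cobounded
  obtain ⟨R₀, hR₀, hR⟩ := exists_forall_norm_gt
    (hψP.and ((hinvt.eventually hright).and (hinvt.eventually hηa.eventually_analyticAt)))
  have hψh : ∀ u, R₀ < ‖u‖ → h (ψ u) = u := fun u hu => by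
    rw [hhζ, hψ, (hR u hu).2.1, inv_inv]
  -- the derivative of the inverse coordinate
  have hψd : ∀ u, R₀ < ‖u‖ → ∃ d, HasDerivAt ψ d u ∧ heightForm X (ψ u) * d = 1 := by
    intro u hu
    have hu0 : u ≠ 0 := norm_pos_iff.1 (hR₀.trans hu)
    have hdψ : DifferentiableAt ℂ ψ u :=
      (hR u hu).2.2.differentiableAt.comp u (differentiableAt_inv hu0)
    refine ⟨deriv ψ u, hdψ.hasDerivAt, ?_⟩
    obtain ⟨⟨h1, h2⟩, -⟩ := (hR u hu).1
    have hc : HasDerivAt (h ∘ ψ) (heightForm X (ψ u) * deriv ψ u) u :=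
      (hhd _ h1 h2).1.comp u hdψ.hasDerivAt
    refine hc.unique ((hasDerivAt_id u).congr_of_eventuallyEq ?_)
    filter_upwards [(isOpen_norm_gt R₀).mem_nhds hu] with w hw using hψh w hw
  have hgd : ∀ z, 0 < ‖z‖ → ‖z‖ < ρ → gaussMap X z ≠ 0 ∧
      HasDerivAt (gaussMap X) (a z / z ^ 2 * gaussMap X z) z := by
    intro z h1 h2
    have hz : z ^ 2 ≠ 0 := pow_ne_zero 2 (norm_pos_iff.1 h1)
    have hl := (hPz z h1 h2).1.2
    have hne : logDeriv (gaussMap X) z ≠ 0 := by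
      rw [hl]; exact div_ne_zero (hP z h2).1.2.1 hz
    rw [logDeriv_apply] at hne hl
    have hg0 : gaussMap X z ≠ 0 := fun h0 => hne (by rw [h0, div_zero])
    have hd0 : deriv (gaussMap X) z ≠ 0 := fun h0 => hne (by rw [h0, zero_div])
    refine ⟨hg0, (differentiableAt_of_deriv_ne_zero hd0).hasDerivAt.congr_deriv ?_⟩
    rw [← hl, div_mul_cancel₀ _ hg0]
  refine ⟨max R₀ δ⁻¹, ψ, h, fun u => (X (ψ u) 0 : ℂ) + Complex.I * X (ψ u) 1,
    fun u => gaussMap X (ψ u), L, ⟨hψt, hht, ?_, fun u _ => rfl, fun u hu => ?_⟩,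
    ⟨by positivity, fun w hw => hLδ w ?_, ?_, fun u hu => ?_, fun u hu => ?_, fun u hu => ?_⟩⟩
  · filter_upwards [nhdsWithin_le_nhds hleft] with z hz
    rw [hψ, hhζ]
    simpa using hz
  · have hu' := (le_max_left _ _).trans_lt hu
    obtain ⟨⟨h1, h2⟩, -⟩ := (hR u hu').1
    rw [(hhd _ h1 h2).2, hψh u hu']
  · have h1 : ‖w‖ < (max R₀ δ⁻¹)⁻¹ := by simpa using hw
    exact h1.trans_le (inv_le_of_inv_le₀ hδ (le_max_right _ _))
  · simp only [hL, hη0]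
    exact div_ne_zero ha0 hb0
  · obtain ⟨⟨h1, h2⟩, -⟩ := (hR u ((le_max_left _ _).trans_lt hu)).1
    exact (hgd _ h1 h2).1
  · have hu' := (le_max_left _ _).trans_lt hu
    obtain ⟨⟨h1, h2⟩, -⟩ := (hR u hu').1
    obtain ⟨d, hd, hd1⟩ := hψd u hu'
    have hz : ψ u ≠ 0 := norm_pos_iff.1 h1
    refine ((hgd _ h1 h2).2.comp u hd).congr_deriv ?_
    have hb1 := (hP _ h2).1.2.2
    rw [(hPz _ h1 h2).2] at hd1
    have hd2 : d = ψ u ^ 2 / b (ψ u) := by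
      rw [eq_div_iff hb1]
      field_simp at hd1
      linear_combination hd1
    rw [hd2]
    simp only [hL]
    change _ = a (ψ u) / b (ψ u) * _
    field_simp
  · have hu' := (le_max_left _ _).trans_lt hu
    obtain ⟨⟨h1, h2⟩, -⟩ := (hR u hu').1
    obtain ⟨d, hd, hd1⟩ := hψd u hu'
    have hω0 : heightForm X (ψ u) ≠ 0 := left_ne_zero_of_mul_eq_one hd1
    have hW := hasFDerivAt_horizontal (hPz _ h1 h2).1.1 (hgd _ h1 h2).1 hω0
    refine (hW.comp u (hd.hasFDerivAt.restrictScalars ℝ)).congr_fderiv ?_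
    ext v
    simp only [ContinuousLinearMap.comp_apply, weierstrassD_apply,
      ContinuousLinearMap.coe_restrictScalars', ContinuousLinearMap.toSpanSingleton_apply,
      smul_eq_mul]
    have e1 : heightForm X (ψ u) / gaussMap X (ψ u) * (v * d) = 1 / gaussMap X (ψ u) * v := by
      linear_combination v / gaussMap X (ψ u) * hd1
    have e2 : gaussMap X (ψ u) * heightForm X (ψ u) * (v * d) = gaussMap X (ψ u) * 1 * v := by
      linear_combination v * gaussMap X (ψ u) * hd1
    rw [e1, e2]

/-! ### The axis: consequences of containing a vertical ray -/

/-- Along a set on which `f` is constant, the differential of `f` at an accumulation point kills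
the secant directions to first order. -/
theorem isLittleO_apply_of_eq_const {F : Type*} [NormedAddCommGroup F] [NormedSpace ℝ F]
    {f : ℂ → F} {f' : ℂ →L[ℝ] F} {u : ℂ} {D : Set ℂ} (hf : HasFDerivAt f f' u)
    (hD : ∀ x ∈ D, f x = f u) :
    (fun x => f' (x - u)) =o[𝓝[≠] u ⊓ 𝓟 D] fun x => x - u := by
  have h := (hf.isLittleO.mono (nhdsWithin_le_nhds (s := {u}ᶜ))).mono
    (inf_le_left : 𝓝[≠] u ⊓ 𝓟 D ≤ 𝓝[≠] u)
  refine h.neg_left.congr' ?_ EventuallyEq.rfl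
  filter_upwards [mem_inf_of_right (mem_principal_self D)] with x hx
  rw [hD x hx]
  simp

theorem not_isLittleO_sub {u : ℂ} {D : Set ℂ} (h : AccPt u (𝓟 D)) :
    ¬ (fun x : ℂ => x - u) =o[𝓝[≠] u ⊓ 𝓟 D] fun x => x - u := by
  have : (𝓝[≠] u ⊓ 𝓟 D).NeBot := h
  refine Asymptotics.isLittleO_irrefl (Eventually.frequently ?_)
  filter_upwards [mem_inf_of_left self_mem_nhdsWithin] with x hx
  exact sub_ne_zero.2 hx

/-- At an accumulation point of a fibre of `W` the Gauss map has modulus `1`. -/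
theorem norm_gauss_eq_one {W : ℂ → ℂ} {g u : ℂ} {D : Set ℂ} (hg : g ≠ 0)
    (hW : HasFDerivAt W (weierstrassD g 1) u) (hD : ∀ x ∈ D, W x = W u) (hacc : AccPt u (𝓟 D)) :
    ‖g‖ = 1 := by
  by_contra hne
  have h := isLittleO_apply_of_eq_const hW hD
  refine not_isLittleO_sub hacc (Asymptotics.IsBigO.trans_isLittleO ?_ h)
  have hk : 0 < |‖g‖⁻¹ - ‖g‖| := by
    rw [abs_pos, sub_ne_zero]
    intro h1
    have h2 : 0 < ‖g‖ := norm_pos_iff.2 hg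
    have h3 : (‖g‖ - 1) * (‖g‖ + 1) = 0 := by
      field_simp at h1
      linarith
    rcases mul_eq_zero.1 h3 with h4 | h4
    · exact hne (by linarith)
    · linarith
  refine Asymptotics.IsBigO.of_bound (2 / |‖g‖⁻¹ - ‖g‖|) (Eventually.of_forall fun x => ?_)
  rw [weierstrassD_apply, norm_div, Complex.norm_ofNat, div_mul_div_cancel₀' two_ne_zero,
    le_div_iff₀ hk]
  refine le_trans (le_of_eq ?_) (abs_norm_sub_norm_le _ _)
  rw [RCLike.norm_conj, norm_mul, norm_mul, mul_one, one_div, norm_inv, ← sub_mul, abs_mul,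
    abs_norm, mul_comm]

/-- A fibre of `W` is horizontal at its accumulation points, so that the derivative in the
direction `1` of a function which vanishes on the fibre vanishes there. -/
theorem apply_one_eq_zero {W : ℂ → ℂ} {g u : ℂ} {D : Set ℂ} (hg : g ≠ 0)
    (hW : HasFDerivAt W (weierstrassD g 1) u) (hD : ∀ x ∈ D, W x = W u) (hacc : AccPt u (𝓟 D))
    {f : ℂ → ℝ} {f' : ℂ →L[ℝ] ℝ} (hf : HasFDerivAt f f' u) (hfD : ∀ x ∈ D, f x = f u) :
    f' 1 = 0 := by
  have hg1 := norm_gauss_eq_one hg hW hD hacc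
  by_contra hne
  have him : (fun x : ℂ => (x - u).im) =o[𝓝[≠] u ⊓ 𝓟 D] fun x => x - u := by
    have h := isLittleO_apply_of_eq_const hW hD
    refine Asymptotics.IsBigO.trans_isLittleO (Asymptotics.IsBigO.of_bound 1
      (Eventually.of_forall fun x => ?_)) h
    have hc : starRingEnd ℂ (1 / g) = g := by
      rw [one_div, Complex.inv_def, Complex.normSq_eq_norm_sq, hg1]
      simp
    have : weierstrassD g 1 (x - u) = -(g * Complex.I * ((x - u).im : ℂ)) := by
      rw [weierstrassD_apply, map_mul, hc]
      have := Complex.sub_conj (x - u)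
      push_cast at this
      linear_combination -g / 2 * this
    rw [this, norm_neg, norm_mul, norm_mul, hg1, Complex.norm_I, Complex.norm_real]
    simp
  have hre : (fun x : ℂ => (x - u).re) =o[𝓝[≠] u ⊓ 𝓟 D] fun x => x - u := by
    have h := (isLittleO_apply_of_eq_const hf hfD).sub (him.const_mul_left (f' Complex.I))
    refine Asymptotics.IsBigO.trans_isLittleO (Asymptotics.IsBigO.of_bound |f' 1|⁻¹
      (Eventually.of_forall fun x => ?_)) h
    have hx : x - u = (x - u).re • (1 : ℂ) + (x - u).im • Complex.I := by
      conv_lhs => rw [← Complex.re_add_im (x - u)]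
      simp
    have : f' (x - u) - f' Complex.I * (x - u).im = f' 1 * (x - u).re := by
      conv_lhs => rw [hx, map_add, map_smul, map_smul, ← hx]
      simp only [smul_eq_mul]
      ring
    rw [this, norm_mul, Real.norm_eq_abs (f' 1), inv_mul_cancel_left₀ (abs_ne_zero.2 hne)]
  refine not_isLittleO_sub hacc ?_
  refine Asymptotics.IsBigO.trans_isLittleO (Asymptotics.IsBigO.of_bound 1
    (Eventually.of_forall fun x => ?_)) (hre.norm_left.add him.norm_left)
  rw [one_mul]
  exact (Complex.norm_le_abs_re_add_abs_im _).trans (le_abs_self _)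

theorem IsEndData.mono {R R' : ℝ} {W G L : ℂ → ℂ} (h : IsEndData R W G L) (hR : R ≤ R') :
    IsEndData R' W G L where
  pos := h.pos.trans_le hR
  analytic := h.analytic.mono (Metric.ball_subset_ball (inv_anti₀ h.pos hR))
  ne_zero := h.ne_zero
  gauss_ne_zero u hu := h.gauss_ne_zero u (hR.trans_lt hu)
  gauss_deriv u hu := h.gauss_deriv u (hR.trans_lt hu)
  hasFDerivAt u hu := h.hasFDerivAt u (hR.trans_lt hu)

namespace IsEndData

variable {R : ℝ} {W G L : ℂ → ℂ}

theorem differentiableOn_logDeriv (h : IsEndData R W G L) :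
    DifferentiableOn ℂ (fun u => L u⁻¹) {u | R < ‖u‖} := by
  intro u hu
  have hu0 : u ≠ 0 := norm_pos_iff.1 (h.pos.trans hu)
  have hmem : u⁻¹ ∈ Metric.ball (0 : ℂ) R⁻¹ := by
    rw [mem_ball_zero_iff, norm_inv]
    exact inv_strictAnti₀ h.pos hu
  exact ((h.analytic _ hmem).differentiableAt.comp u
    (differentiableAt_inv hu0)).differentiableWithinAt

theorem differentiableOn_iteratedDeriv (h : IsEndData R W G L) (n : ℕ) :
    DifferentiableOn ℂ (iteratedDeriv n fun u => L u⁻¹) {u | R < ‖u‖} := by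
  induction n with
  | zero => simpa using h.differentiableOn_logDeriv
  | succ n ih =>
    rw [iteratedDeriv_succ]
    exact ih.deriv (isOpen_norm_gt R)

/-- The derivative of `|G|²` along a horizontal line. -/
theorem hasFDerivAt_norm_sq (h : IsEndData R W G L) {u : ℂ} (hu : R < ‖u‖) :
    ∃ f' : ℂ →L[ℝ] ℝ, HasFDerivAt (fun u => ‖G u‖ ^ 2) f' u ∧
      f' 1 = 2 * ‖G u‖ ^ 2 * (L u⁻¹).re := by
  refine ⟨_, ((h.gauss_deriv u hu).hasFDerivAt.restrictScalars ℝ).norm_sq, ?_⟩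
  simp only [smul_apply, ContinuousLinearMap.comp_apply, ContinuousLinearMap.coe_restrictScalars',
    ContinuousLinearMap.toSpanSingleton_apply, innerSL_apply_apply, Complex.inner, nsmul_eq_mul,
    one_smul]
  rw [mul_assoc, Complex.mul_conj', Nat.cast_ofNat, mul_assoc]
  congr 1
  rw [← Complex.ofReal_pow, Complex.re_mul_ofReal, mul_comm]

/-- On a perfect subset of a fibre of `W`, all derivatives of the logarithmic derivative of the Gauss
map are purely imaginary. -/
theorem re_iteratedDeriv_eq_zero (h : IsEndData R W G L) {w₀ : ℂ} {D : Set ℂ} (hD : Preperfect D)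
    (hDR : ∀ u ∈ D, R < ‖u‖) (hDW : ∀ u ∈ D, W u = w₀) (n : ℕ) :
    ∀ u ∈ D, (iteratedDeriv n (fun u => L u⁻¹) u).re = 0 := by
  have hstep : ∀ u ∈ D, ∀ (f : ℂ → ℝ) (f' : ℂ →L[ℝ] ℝ), HasFDerivAt f f' u →
      (∀ x ∈ D, f x = f u) → f' 1 = 0 := fun u hu f f' hf hfD =>
    apply_one_eq_zero (h.gauss_ne_zero u (hDR u hu)) (h.hasFDerivAt u (hDR u hu))
      (fun x hx => (hDW x hx).trans (hDW u hu).symm) (hD u hu) hf hfD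
  have hG : ∀ u ∈ D, ‖G u‖ = 1 := fun u hu =>
    norm_gauss_eq_one (h.gauss_ne_zero u (hDR u hu)) (h.hasFDerivAt u (hDR u hu))
      (fun x hx => (hDW x hx).trans (hDW u hu).symm) (hD u hu)
  induction n with
  | zero =>
    intro u hu
    obtain ⟨f', hf, hf1⟩ := h.hasFDerivAt_norm_sq (hDR u hu)
    have := hstep u hu _ f' hf fun x hx => by rw [hG x hx, hG u hu]
    rw [hf1, hG u hu] at this
    simpa using this
  | succ n ih =>
    intro u hu
    have hd := ((h.differentiableOn_iteratedDeriv n).differentiableAt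
      ((isOpen_norm_gt R).mem_nhds (hDR u hu))).hasDerivAt
    have hre := Complex.reCLM.hasFDerivAt.comp u (hd.hasFDerivAt.restrictScalars ℝ)
    have := hstep u hu _ _ hre fun x hx => (ih x hx).trans (ih u hu).symm
    rw [iteratedDeriv_succ]
    simpa using this

/-- An uncountable fibre of `W` forces the logarithmic derivative of the Gauss map to be purely
imaginary, the Gauss map to be unimodular and `W` to be constant along a horizontal half-line; only
that this happens at points arbitrarily far out on a horizontal line is recorded. -/
theorem exists_axis (h : IsEndData R W G L) {w₀ : ℂ} {S : Set ℝ} (hS : ¬ S.Countable)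
    (hZ : ∀ s ∈ S, ∃ u : ℂ, R + 1 ≤ ‖u‖ ∧ u.re = s ∧ W u = w₀) :
    ∃ y₀ : ℝ, ∀ B : ℝ, ∃ x : ℝ, B < |x| ∧
      (L ((x : ℂ) + y₀ * Complex.I)⁻¹).re = 0 ∧ ‖G (x + y₀ * Complex.I)‖ = 1 ∧
      W (x + y₀ * Complex.I) = w₀ := by
  set Z : Set ℂ := {u | R + 1 ≤ ‖u‖ ∧ W u = w₀} with hZdef
  have hcl : IsClosed Z := by
    have hc : ContinuousOn W {u | R + 1 ≤ ‖u‖} := fun u hu =>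
      (h.hasFDerivAt u (by have : R + 1 ≤ ‖u‖ := hu; linarith)).continuousAt.continuousWithinAt
    exact hc.preimage_isClosed_of_isClosed (isClosed_le continuous_const continuous_norm)
      (isClosed_singleton (x := w₀))
  have hunc : ¬ Z.Countable := fun hc => by
    refine hS ((hc.image Complex.re).mono fun s hs => ?_)
    obtain ⟨u, h1, h2, h3⟩ := hZ s hs
    exact ⟨u, ⟨h1, h3⟩, h2⟩
  obtain ⟨V, D, hV, hD, hVD⟩ := exists_countable_union_perfect_of_isClosed hcl
  have hDne : D.Nonempty := by
    rw [Set.nonempty_iff_ne_empty]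
    rintro rfl
    rw [Set.union_empty] at hVD
    exact hunc (hVD ▸ hV)
  have hDZ : D ⊆ Z := hVD ▸ Set.subset_union_right
  have hDR : ∀ u ∈ D, R < ‖u‖ := fun u hu => by
    have := (hDZ hu).1
    linarith
  obtain ⟨v, hv⟩ := hDne
  have htaylor := fun n => h.re_iteratedDeriv_eq_zero hD.acc hDR (fun u hu => (hDZ hu).2) n v hv
  have hGv : ‖G v‖ = 1 := norm_gauss_eq_one (h.gauss_ne_zero v (hDR v hv))
    (h.hasFDerivAt v (hDR v hv)) (fun x hx => (hDZ hx).2.trans (hDZ hv).2.symm) (hD.acc v hv)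
  -- the half-line through `v` pointing away from the origin
  obtain ⟨T, hTc, hvT, hTn, hTu⟩ : ∃ T : Set ℝ, Convex ℝ T ∧ v.re ∈ T ∧
      (∀ x ∈ T, |v.re| ≤ |x|) ∧ ∀ B : ℝ, ∃ x ∈ T, B < |x| := by
    rcases le_total 0 v.re with h0 | h0
    · refine ⟨Set.Ici v.re, convex_Ici _, Set.self_mem_Ici, fun x hx => abs_le_abs_of_nonneg h0 hx,
        fun B => ⟨max v.re (B + 1), Set.mem_Ici.2 (le_max_left _ _), ?_⟩⟩
      linarith [le_max_right v.re (B + 1), le_abs_self (max v.re (B + 1))]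
    · refine ⟨Set.Iic v.re, convex_Iic _, Set.self_mem_Iic, fun x hx => ?_,
        fun B => ⟨min v.re (-B - 1), Set.mem_Iic.2 (min_le_left _ _), ?_⟩⟩
      · exact abs_le_abs_of_nonpos h0 hx
      · linarith [min_le_right v.re (-B - 1), neg_abs_le (min v.re (-B - 1))]
  set ι : ℝ → ℂ := fun x => (x : ℂ) + v.im * Complex.I with hι
  have hιre : ∀ x, (ι x).re = x := fun x => by simp [hι]
  have hιim : ∀ x, (ι x).im = v.im := fun x => by simp [hι]
  have hιv : ι v.re = v := Complex.re_add_im v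
  have hιd : ∀ x, HasDerivAt ι 1 x := fun x => by
    have := (Complex.ofRealCLM.hasDerivAt (x := x)).add_const (v.im * Complex.I)
    rwa [Complex.ofRealCLM_apply, Complex.ofReal_one] at this
  have hιR : ∀ x ∈ T, R < ‖ι x‖ := fun x hx => by
    refine (hDR v hv).trans_le ?_
    rw [Complex.norm_def, Complex.norm_def]
    apply Real.sqrt_le_sqrt
    have := sq_le_sq.2 (hTn x hx)
    simp only [Complex.normSq_apply, hιre, hιim]
    linarith
  have hanal : AnalyticOnNhd ℝ (fun x => (L (ι x)⁻¹).re) T := by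
    intro x hx
    have h1 : AnalyticAt ℂ (fun u => L u⁻¹) (ι x) :=
      h.differentiableOn_logDeriv.analyticAt ((isOpen_norm_gt R).mem_nhds (hιR x hx))
    have h2 : AnalyticAt ℝ ι x := (Complex.ofRealCLM.analyticAt x).add analyticAt_const
    exact (Complex.reCLM.analyticAt _).comp ((h1.restrictScalars (𝕜 := ℝ)).comp h2)
  have hlocal : (fun x => (L (ι x)⁻¹).re) =ᶠ[𝓝 v.re] 0 := by
    obtain ⟨δ, hδ, hball⟩ := Metric.isOpen_iff.1 (isOpen_norm_gt R) v (hDR v hv)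
    filter_upwards [Metric.ball_mem_nhds v.re hδ] with x hx
    have hxv : ι x - v = ((x - v.re : ℝ) : ℂ) := by
      apply Complex.ext
      · rw [Complex.sub_re, hιre, Complex.ofReal_re]
      · rw [Complex.sub_im, hιim, Complex.ofReal_im, sub_self]
    have hmem : ι x ∈ Metric.ball v δ := by
      rw [mem_ball_iff_norm, hxv, Complex.norm_real]
      exact hx
    have hsum := Complex.hasSum_taylorSeries_on_ball (h.differentiableOn_logDeriv.mono hball) hmem
    have hterm : ∀ n : ℕ, Complex.reCLM ((n.factorial : ℂ)⁻¹ • (ι x - v) ^ n •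
        iteratedDeriv n (fun u => L u⁻¹) v) = 0 := fun n => by
      rw [Complex.reCLM_apply, hxv, smul_eq_mul, smul_eq_mul, ← Complex.ofReal_natCast,
        ← Complex.ofReal_inv, ← Complex.ofReal_pow, Complex.re_ofReal_mul, Complex.re_ofReal_mul,
        htaylor n, mul_zero, mul_zero]
    have hsum' := Complex.reCLM.hasSum hsum
    simp only [hterm] at hsum'
    exact hsum'.unique hasSum_zero
  have hL0 : ∀ x ∈ T, (L (ι x)⁻¹).re = 0 := fun x hx =>
    hanal.eqOn_zero_of_preconnected_of_eventuallyEq_zero hTc.isPreconnected hvT hlocal hx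
  have hG1 : ∀ x ∈ T, ‖G (ι x)‖ = 1 := by
    intro x hx
    have hd : ∀ x ∈ T, HasDerivWithinAt (fun x => ‖G (ι x)‖ ^ 2) 0 T x := by
      intro x hx
      obtain ⟨f', hf, hf1⟩ := h.hasFDerivAt_norm_sq (hιR x hx)
      rw [hL0 x hx, mul_zero] at hf1
      have := hf.comp_hasDerivAt x (hιd x)
      rw [hf1] at this
      exact this.hasDerivWithinAt
    have := hTc.norm_image_sub_le_of_norm_hasDerivWithin_le (C := 0) hd (by simp) hvT hx
    rw [zero_mul, norm_le_zero_iff, sub_eq_zero, hιv, hGv] at this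
    exact (pow_left_inj₀ (norm_nonneg _) zero_le_one two_ne_zero).1 this
  have hW1 : ∀ x ∈ T, W (ι x) = w₀ := by
    intro x hx
    have hd : ∀ x ∈ T, HasDerivWithinAt (fun x => W (ι x)) 0 T x := by
      intro x hx
      have := (h.hasFDerivAt _ (hιR x hx)).comp_hasDerivAt x (hιd x)
      have h0 : weierstrassD (G (ι x)) 1 1 = 0 := by
        have hc : starRingEnd ℂ (1 / G (ι x)) = G (ι x) := by
          rw [one_div, Complex.inv_def, Complex.normSq_eq_norm_sq, hG1 x hx]
          simp
        rw [weierstrassD_apply, mul_one, hc]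
        ring
      rw [h0] at this
      exact this.hasDerivWithinAt
    have := hTc.norm_image_sub_le_of_norm_hasDerivWithin_le (C := 0) hd (by simp) hvT hx
    rw [zero_mul, norm_le_zero_iff, sub_eq_zero, hιv, (hDZ hv).2] at this
    exact this
  refine ⟨v.im, fun B => ?_⟩
  obtain ⟨x, hx, hB⟩ := hTu B
  exact ⟨x, hB, hL0 x hx, hG1 x hx, hW1 x hx⟩

/-- Vertical translations of the coordinate. -/
theorem translate (h : IsEndData R W G L) (y₀ : ℝ) :
    IsEndData (R + |y₀|) (fun u => W (u + y₀ * Complex.I)) (fun u => G (u + y₀ * Complex.I))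
      (fun w => L (w / (1 + y₀ * Complex.I * w))) := by
  have hny : ‖(y₀ : ℂ) * Complex.I‖ = |y₀| := by simp
  have hu : ∀ u : ℂ, R + |y₀| < ‖u‖ → R < ‖u + y₀ * Complex.I‖ := fun u hu => by
    have := norm_sub_le (u + y₀ * Complex.I) (y₀ * Complex.I)
    rw [add_sub_cancel_right, hny] at this
    linarith
  have hinv : ∀ u : ℂ, R + |y₀| < ‖u‖ →
      u⁻¹ / (1 + y₀ * Complex.I * u⁻¹) = (u + y₀ * Complex.I)⁻¹ := fun u hu => by
    have : u ≠ 0 := norm_pos_iff.1 ((add_pos_of_pos_of_nonneg h.pos (abs_nonneg _)).trans hu)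
    field_simp
  have hadd : ∀ u : ℂ, HasDerivAt (fun u : ℂ => u + y₀ * Complex.I) 1 u := fun u =>
    (hasDerivAt_id u).add_const _
  refine ⟨add_pos_of_pos_of_nonneg h.pos (abs_nonneg _), fun w hw => ?_, ?_,
    fun u hu' => h.gauss_ne_zero _ (hu u hu'), fun u hu' => ?_, fun u hu' => ?_⟩
  · have hRp := h.pos
    have hw' : ‖w‖ * (R + |y₀|) < 1 := by
      rw [mem_ball_zero_iff, ← one_div] at hw
      exact (lt_div_iff₀ (add_pos_of_pos_of_nonneg h.pos (abs_nonneg _))).1 hw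
    have hden : ‖w‖ * R < ‖1 + y₀ * Complex.I * w‖ := by
      have h1 := norm_sub_norm_le (1 : ℂ) (-(y₀ * Complex.I * w))
      rw [sub_neg_eq_add, norm_neg, norm_mul, hny, norm_one] at h1
      nlinarith
    have hden0 : 0 < ‖1 + y₀ * Complex.I * w‖ := lt_of_le_of_lt (by positivity) hden
    have hmem : w / (1 + y₀ * Complex.I * w) ∈ Metric.ball (0 : ℂ) R⁻¹ := by
      rw [mem_ball_zero_iff, norm_div, div_lt_iff₀ hden0, inv_mul_eq_div, lt_div_iff₀ hRp]
      exact hden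
    have hm : AnalyticAt ℂ (fun w : ℂ => w / (1 + y₀ * Complex.I * w)) w := analyticAt_id.div
      (analyticAt_const.add (analyticAt_const.mul analyticAt_id)) (norm_pos_iff.1 hden0)
    exact AnalyticAt.comp (g := L) (f := fun w : ℂ => w / (1 + y₀ * Complex.I * w))
      (h.analytic _ hmem) hm
  · simpa using h.ne_zero
  · have := (h.gauss_deriv _ (hu u hu')).comp u (hadd u)
    rw [mul_one, ← hinv u hu'] at this
    exact this
  · refine ((h.hasFDerivAt _ (hu u hu')).comp u
      ((hadd u).hasFDerivAt.restrictScalars ℝ)).congr_fderiv ?_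
    ext v
    simp

end IsEndData

theorem IsEndChart.translate {X : ℂ → E3} {R : ℝ} {ψ θ W : ℂ → ℂ} (h : IsEndChart X R ψ θ W)
    (y₀ : ℝ) :
    IsEndChart X (R + |y₀|) (fun u => ψ (u + y₀ * Complex.I)) (fun z => θ z - y₀ * Complex.I)
      (fun u => W (u + y₀ * Complex.I)) := by
  have hny : ‖(y₀ : ℂ) * Complex.I‖ = |y₀| := by simp
  have hu : ∀ u : ℂ, R + |y₀| < ‖u‖ → R < ‖u + y₀ * Complex.I‖ := fun u hu => by
    have := norm_sub_le (u + y₀ * Complex.I) (y₀ * Complex.I)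
    rw [add_sub_cancel_right, hny] at this
    linarith
  refine ⟨h.tendsto_param.comp (tendsto_add_const_cobounded _),
    (tendsto_sub_const_cobounded _).comp h.tendsto_coord, ?_,
    fun u hu' => h.horizontal _ (hu u hu'), fun u hu' => ?_⟩
  · filter_upwards [h.left_inv] with z hz
    rwa [sub_add_cancel]
  · rw [h.height _ (hu u hu')]
    simp

/-! ### Weierstrass data with an axis are asymptotically those of a helicoid -/

/-- Since the Gauss map is single valued, a purely imaginary residue of its logarithmic derivative
vanishes: otherwise `|q|` would not return to its value after a turn around the puncture. -/
theorem residue_eq_zero {q : ℂ → ℂ} {κ r : ℝ} (hr : 0 < r)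
    (hq0 : q r ≠ 0) (hq : ∀ u : ℂ, ‖u‖ = r → HasDerivAt q (κ * Complex.I * u⁻¹ * q u) u) :
    κ = 0 := by
  set e : ℝ → ℂ := fun t => r * Complex.exp (t * Complex.I) with he
  have hen : ∀ t, ‖e t‖ = r := fun t => by
    rw [he]
    simp only [norm_mul, Complex.norm_exp_ofReal_mul_I, Complex.norm_real, mul_one]
    exact abs_of_pos hr
  have hed : ∀ t, HasDerivAt e (e t * Complex.I) t := fun t => by
    have h1 : HasDerivAt (fun t : ℝ => (t : ℂ) * Complex.I) Complex.I t := by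
      simpa using (Complex.ofRealCLM.hasDerivAt (x := t)).mul_const Complex.I
    exact (h1.cexp.const_mul (r : ℂ)).congr_deriv (by rw [he]; ring)
  set p : ℝ → ℂ := fun t => q (e t) * ((Real.exp (κ * t) : ℝ) : ℂ) with hp
  have hpd : ∀ t, HasDerivAt p 0 t := fun t => by
    have h1 : HasDerivAt (fun t => q (e t)) (-κ * q (e t)) t := by
      refine ((hq _ (hen t)).comp t (hed t)).congr_deriv ?_
      have : e t ≠ 0 := norm_pos_iff.1 (by rw [hen]; exact hr)
      field_simp
      linear_combination κ * q (e t) * Complex.I_sq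
    have h2 : HasDerivAt (fun t : ℝ => Real.exp (κ * t)) (Real.exp (κ * t) * κ) t := by
      have := ((hasDerivAt_id t).const_mul κ).exp
      simpa using this
    refine (h1.mul h2.ofReal_comp).congr_deriv ?_
    push_cast
    ring
  have hconst := is_const_of_deriv_eq_zero (fun t => (hpd t).differentiableAt)
    (fun t => (hpd t).deriv) 0 (2 * Real.pi)
  have he0 : e 0 = r := by simp [he]
  have he1 : e (2 * Real.pi) = r := by
    rw [he]
    push_cast
    rw [Complex.exp_two_pi_mul_I, mul_one]
  simp only [hp, he0, he1, mul_zero, Real.exp_zero] at hconst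
  have h1 := mul_left_cancel₀ hq0 hconst
  have h2 : Real.exp (κ * (2 * Real.pi)) = 1 := by exact_mod_cast h1.symm
  rw [Real.exp_eq_one_iff] at h2
  simpa [Real.pi_ne_zero] using h2

namespace IsEndData

variable {R : ℝ} {W G L : ℂ → ℂ}

/-- Schwarz reflection for the logarithmic derivative of the Gauss map. -/
theorem eventually_conj (h : IsEndData R W G L)
    (hL : ∀ B : ℝ, ∃ x : ℝ, B < |x| ∧ (L (x : ℂ)⁻¹).re = 0) :
    ∀ᶠ w in 𝓝 (0 : ℂ), starRingEnd ℂ (L (starRingEnd ℂ w)) = -L w := by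
  have hLa : AnalyticAt ℂ L 0 := h.analytic 0 (Metric.mem_ball_self (inv_pos.2 h.pos))
  have hd := Complex.analyticAt_iff_eventually_differentiableAt.1 hLa
  have hconj : Tendsto (starRingEnd ℂ) (𝓝 0) (𝓝 0) := by
    simpa using (Complex.continuous_conj.tendsto 0)
  have hLc : AnalyticAt ℂ (fun w => starRingEnd ℂ (L (starRingEnd ℂ w))) 0 := by
    rw [Complex.analyticAt_iff_eventually_differentiableAt]
    filter_upwards [hconj.eventually hd] with w hw
    exact differentiableAt_conj_conj_iff.2 hw
  have hfreq : ∃ᶠ w in 𝓝[≠] (0 : ℂ), L w + starRingEnd ℂ (L (starRingEnd ℂ w)) = 0 := by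
    rw [frequently_iff]
    intro U hU
    obtain ⟨R', hR', hRU⟩ := exists_forall_norm_gt (tendsto_inv_cobounded_nhdsNE hU)
    obtain ⟨x, hx, hx0⟩ := hL R'
    refine ⟨(x : ℂ)⁻¹, hRU _ (by simpa using hx), ?_⟩
    have : starRingEnd ℂ (x : ℂ)⁻¹ = (x : ℂ)⁻¹ := by simp
    rw [this, Complex.add_conj, hx0]
    simp
  have := ((hLa.add hLc).frequently_zero_iff_eventually_zero).1 hfreq
  filter_upwards [this] with w hw
  have hw' : L w + starRingEnd ℂ (L (starRingEnd ℂ w)) = 0 := hw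
  linear_combination hw'

/-- If the logarithmic derivative of the Gauss map is purely imaginary far out on the real axis, and
the Gauss map is unimodular there, then `G = exp (i (τ u + c) + E (1 / u))` with `E 0 = 0`. -/
theorem exists_gauss_eq_exp (h : IsEndData R W G L)
    (hconj : ∀ w : ℂ, ‖w‖ < R⁻¹ → starRingEnd ℂ (L (starRingEnd ℂ w)) = -L w)
    (hG : ∀ B : ℝ, ∃ x : ℝ, B < |x| ∧ ‖G x‖ = 1) :
    ∃ (τ c : ℝ) (E : ℂ → ℂ), τ ≠ 0 ∧ Tendsto E (𝓝 0) (𝓝 0) ∧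
      ∀ u, R < ‖u‖ → G u = Complex.exp (Complex.I * (τ * u + c) + E u⁻¹) := by
  have hRi : 0 < R⁻¹ := inv_pos.2 h.pos
  have hball := Metric.ball_mem_nhds (0 : ℂ) hRi
  -- a number `z` with `conj z = -z` is `i` times a real number
  have himag : ∀ z : ℂ, starRingEnd ℂ z = -z → z = z.im * Complex.I := fun z hz => by
    have : z.re = -z.re := by simpa using congrArg Complex.re hz
    apply Complex.ext
    · simp; linarith
    · simp
  have hα : L 0 = (L 0).im * Complex.I := himag _ (by simpa using hconj 0 (by simpa using hRi))
  have hβ : deriv L 0 = (deriv L 0).im * Complex.I := by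
    refine himag _ ?_
    have hLd : HasDerivAt L (deriv L 0) 0 :=
      (h.analytic 0 (Metric.mem_ball_self hRi)).differentiableAt.hasDerivAt
    have h1 := hLd.conj_conj
    rw [map_zero] at h1
    have h2 : HasDerivAt (fun w => -L w) (-deriv L 0) 0 := hLd.neg
    refine h1.unique (h2.congr_of_eventuallyEq ?_)
    filter_upwards [hball] with w hw
    exact hconj w (by simpa using hw)
  set τ := (L 0).im with hτ
  set κ := (deriv L 0).im with hκ
  have hτ0 : τ ≠ 0 := fun h0 => h.ne_zero (by rw [hα, h0]; simp)
  have hLdiff : DifferentiableOn ℂ L (Metric.ball 0 R⁻¹) := h.analytic.differentiableOn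
  have hm : DifferentiableOn ℂ (dslope (dslope L 0) 0) (Metric.ball 0 R⁻¹) :=
    (Complex.differentiableOn_dslope hball).2 ((Complex.differentiableOn_dslope hball).2 hLdiff)
  set m := dslope (dslope L 0) 0 with hmdef
  have hexp : ∀ w, L w = τ * Complex.I + κ * Complex.I * w + w ^ 2 * m w := fun w => by
    have e1 : w * dslope L 0 w = L w - L 0 := by simpa using sub_smul_dslope L 0 w
    have e2 : w * m w = dslope L 0 w - deriv L 0 := by
      simpa [dslope_same] using sub_smul_dslope (dslope L 0) 0 w
    rw [← hα, ← hβ]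
    linear_combination -e1 - w * e2
  obtain ⟨E, hE0, hE⟩ := hm.neg.isExactOn_ball.with_val_at 0 0
  have hEt : Tendsto E (𝓝 0) (𝓝 0) := by
    have := (hE 0 (Metric.mem_ball_self hRi)).continuousAt.tendsto
    rwa [hE0] at this
  set q : ℂ → ℂ := fun u => G u * Complex.exp (-(τ * Complex.I * u + E u⁻¹)) with hq
  have hu0 : ∀ u : ℂ, R < ‖u‖ → u ≠ 0 := fun u hu => norm_pos_iff.1 (h.pos.trans hu)
  have hqd : ∀ u, R < ‖u‖ → HasDerivAt q (κ * Complex.I * u⁻¹ * q u) u := by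
    intro u hu
    have hne := hu0 u hu
    have hmem : u⁻¹ ∈ Metric.ball (0 : ℂ) R⁻¹ := by
      rw [mem_ball_zero_iff, norm_inv]
      exact inv_strictAnti₀ h.pos hu
    have h1 : HasDerivAt (fun u : ℂ => E u⁻¹) (m u⁻¹ * (u⁻¹) ^ 2) u := by
      refine ((hE _ hmem).comp u (hasDerivAt_inv hne)).congr_deriv ?_
      simp
    have h2 : HasDerivAt (fun u : ℂ => -(τ * Complex.I * u + E u⁻¹))
        (-(τ * Complex.I + m u⁻¹ * (u⁻¹) ^ 2)) u := by
      exact (((hasDerivAt_id u).const_mul (τ * Complex.I)).add h1).neg.congr_deriv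
        (by rw [mul_one])
    refine ((h.gauss_deriv u hu).mul h2.cexp).congr_deriv ?_
    rw [hexp u⁻¹, hq]
    ring
  have hκ0 : κ = 0 := by
    refine residue_eq_zero (q := q) (r := R + 1) (by linarith [h.pos]) ?_ fun u hu =>
      hqd u (by linarith)
    refine mul_ne_zero (h.gauss_ne_zero _ ?_) (Complex.exp_ne_zero _)
    rw [Complex.norm_real, Real.norm_eq_abs, abs_of_pos (by linarith [h.pos])]
    linarith
  have hqd0 : ∀ u, R < ‖u‖ → HasDerivAt q 0 u := fun u hu => by
    simpa [hκ0] using hqd u hu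
  obtain ⟨k, hk⟩ := (isOpen_norm_gt R).exists_is_const_of_deriv_eq_zero
    (isPreconnected_norm_gt h.pos.le)
    (fun u hu => (hqd0 u hu).differentiableAt.differentiableWithinAt)
    (fun u hu => (hqd0 u hu).deriv)
  have hGk : ∀ u, R < ‖u‖ → G u = k * Complex.exp (τ * Complex.I * u + E u⁻¹) := fun u hu => by
    rw [← hk u hu, hq]
    simp only
    rw [mul_assoc, ← Complex.exp_add, neg_add_cancel, Complex.exp_zero, mul_one]
  have hk1 : ‖k‖ = 1 := by
    by_contra hne
    have ht : Tendsto (fun u : ℂ => ‖k‖ * Real.exp (E u⁻¹).re) (Bornology.cobounded ℂ)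
        (𝓝 (‖k‖ * Real.exp (0 : ℂ).re)) :=
      (((Real.continuous_exp.comp Complex.continuous_re).tendsto 0).comp
        (hEt.comp tendsto_inv₀_cobounded)).const_mul _
    rw [Complex.zero_re, Real.exp_zero, mul_one] at ht
    obtain ⟨B, hB, hBne⟩ := exists_forall_norm_gt (ht.eventually_ne hne)
    obtain ⟨x, hx, hGx⟩ := hG (max B R)
    have hxB : B < ‖(x : ℂ)‖ := by simpa using (le_max_left _ _).trans_lt hx
    have hxR : R < ‖(x : ℂ)‖ := by simpa using (le_max_right _ _).trans_lt hx
    refine hBne x hxB ?_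
    rw [← hGx, hGk x hxR, norm_mul, Complex.norm_exp]
    simp
  refine ⟨τ, k.arg, E, hτ0, hEt, fun u hu => ?_⟩
  rw [hGk u hu]
  conv_lhs => rw [← Complex.norm_mul_exp_arg_mul_I k, hk1]
  rw [Complex.ofReal_one, one_mul, ← Complex.exp_add]
  congr 1
  ring

/-- Reflection in the real axis inverts the Gauss map. -/
theorem gauss_conj (h : IsEndData R W G L)
    (hconj : ∀ w : ℂ, ‖w‖ < R⁻¹ → starRingEnd ℂ (L (starRingEnd ℂ w)) = -L w)
    {x : ℝ} (hx : R < |x|) (hG : ‖G x‖ = 1) {u : ℂ} (hu : R < ‖u‖) :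
    G u * starRingEnd ℂ (G (starRingEnd ℂ u)) = 1 := by
  have hd : ∀ u, R < ‖u‖ →
      HasDerivAt (fun u => G u * starRingEnd ℂ (G (starRingEnd ℂ u))) 0 u := by
    intro u hu
    have hne : u ≠ 0 := norm_pos_iff.1 (h.pos.trans hu)
    have h2 := (h.gauss_deriv (starRingEnd ℂ u) (by simpa using hu)).conj_conj
    rw [Complex.conj_conj] at h2
    refine ((h.gauss_deriv u hu).mul h2).congr_deriv ?_
    have h3 := hconj u⁻¹ (by rw [norm_inv]; exact inv_strictAnti₀ h.pos hu)
    rw [map_inv₀] at h3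
    rw [map_mul, h3]
    simp only [Function.comp_apply]
    ring
  rw [(isOpen_norm_gt R).is_const_of_deriv_eq_zero (isPreconnected_norm_gt h.pos.le)
    (fun u hu => (hd u hu).differentiableAt.differentiableWithinAt)
    (fun u hu => (hd u hu).deriv) (x := u) (y := x) hu (by simpa using hx)]
  rw [Complex.conj_ofReal, Complex.mul_conj, Complex.normSq_eq_norm_sq, hG]
  simp

/-- Reflection in the real axis is induced by the rotation of the surface about its axis. -/
theorem horizontal_conj (h : IsEndData R W G L)
    (hG : ∀ u : ℂ, R < ‖u‖ → G u * starRingEnd ℂ (G (starRingEnd ℂ u)) = 1)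
    {x : ℝ} (hx : R < |x|) {u : ℂ} (hu : R < ‖u‖) :
    W u + W (starRingEnd ℂ u) = 2 * W x := by
  have hd : ∀ u, R < ‖u‖ →
      HasFDerivAt (fun u => W u + W (starRingEnd ℂ u)) (0 : ℂ →L[ℝ] ℂ) u := by
    intro u hu
    have hcu : R < ‖starRingEnd ℂ u‖ := by simpa using hu
    have h1 : HasFDerivAt (fun u => W (starRingEnd ℂ u)) _ u :=
      (h.hasFDerivAt _ hcu).comp u (Complex.conjCLE : ℂ →L[ℝ] ℂ).hasFDerivAt
    refine ((h.hasFDerivAt u hu).add h1).congr_fderiv ?_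
    ext v
    have e1 : (1 / G u) = starRingEnd ℂ (G (starRingEnd ℂ u)) := by
      rw [div_eq_iff (h.gauss_ne_zero u hu), mul_comm, hG u hu]
    have e2 : (1 / G (starRingEnd ℂ u)) = starRingEnd ℂ (G u) := by
      have := hG _ hcu
      rw [Complex.conj_conj] at this
      rw [div_eq_iff (h.gauss_ne_zero _ hcu), mul_comm, this]
    simp only [add_apply, ContinuousLinearMap.comp_apply, weierstrassD_apply,
      ContinuousLinearEquiv.coe_coe, Complex.conjCLE_apply, e1, e2, map_mul, Complex.conj_conj,
      zero_apply]
    ring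
  rw [(isOpen_norm_gt R).is_const_of_fderiv_eq_zero (𝕜 := ℝ) (isPreconnected_norm_gt h.pos.le)
    (fun u hu => (hd u hu).differentiableAt.differentiableWithinAt)
    (fun u hu => (hd u hu).fderiv) (x := u) (y := x) hu (by simpa using hx)]
  rw [Complex.conj_ofReal]
  ring

/-- After a similarity, Weierstrass data with an axis satisfy `IsHelicoidal`. -/
theorem exists_isHelicoidal (h : IsEndData R W G L) {w₀ : ℂ}
    (haxis : ∀ B : ℝ, ∃ x : ℝ, B < |x| ∧ (L (x : ℂ)⁻¹).re = 0 ∧ ‖G x‖ = 1 ∧ W x = w₀) :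
    ∃ τ c R' : ℝ, τ ≠ 0 ∧ |τ| * R ≤ R' ∧ IsHelicoidal
      (fun u => Complex.I * Complex.exp (-(c * Complex.I)) * τ * (W (u / τ) - w₀)) R' := by
  obtain ⟨δ, hδ, hconj⟩ := exists_forall_norm_lt (h.eventually_conj fun B => by
    obtain ⟨x, h1, h2, -⟩ := haxis B
    exact ⟨x, h1, h2⟩)
  set R₁ := max R δ⁻¹ with hR₁
  have h' : IsEndData R₁ W G L := h.mono (le_max_left _ _)
  have hconj' : ∀ w : ℂ, ‖w‖ < R₁⁻¹ → starRingEnd ℂ (L (starRingEnd ℂ w)) = -L w :=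
    fun w hw => hconj w (hw.trans_le (inv_le_of_inv_le₀ hδ (le_max_right _ _)))
  obtain ⟨τ, c, E, hτ, hE, hGE⟩ := h'.exists_gauss_eq_exp hconj' fun B => by
    obtain ⟨x, h1, -, h2, -⟩ := haxis B
    exact ⟨x, h1, h2⟩
  obtain ⟨x₀, hx₀, -, hGx, hWx⟩ := haxis R₁
  have hsym : ∀ u, R₁ < ‖u‖ → W u + W (starRingEnd ℂ u) = 2 * w₀ := fun u hu => by
    rw [← hWx]
    exact h'.horizontal_conj (fun u hu => h'.gauss_conj hconj' hx₀ hGx hu) hx₀ hu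
  have hτ' : (τ : ℂ) ≠ 0 := Complex.ofReal_ne_zero.2 hτ
  have hτp : 0 < |τ| := abs_pos.2 hτ
  have hu : ∀ u : ℂ, |τ| * R₁ < ‖u‖ → R₁ < ‖u / τ‖ := fun u hu => by
    rw [norm_div, Complex.norm_real, Real.norm_eq_abs, lt_div_iff₀ hτp, mul_comm]
    exact hu
  refine ⟨τ, c, |τ| * R₁, hτ, by gcongr; exact le_max_left _ _, ?_, fun u hu' => ?_, fun ε hε => ?_⟩
  · refine continuousOn_const.mul (ContinuousOn.sub ?_ continuousOn_const)
    have hc : ContinuousOn W {u | R₁ < ‖u‖} := fun u hu =>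
      (h'.hasFDerivAt u hu).continuousAt.continuousWithinAt
    exact hc.comp (continuous_id.div_const _).continuousOn fun u hu' => hu u hu'
  · have := hsym _ (hu u hu')
    rw [map_div₀, Complex.conj_ofReal] at this
    linear_combination Complex.I * Complex.exp (-(c * Complex.I)) * τ * this
  · have ht : Tendsto (fun u : ℂ => E (u / τ)⁻¹) (Bornology.cobounded ℂ) (𝓝 0) := by
      have : Tendsto (fun u : ℂ => (u / τ)⁻¹) (Bornology.cobounded ℂ) (𝓝 0) := by
        have := (tendsto_inv₀_cobounded (α := ℂ)).const_mul (τ : ℂ)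
        rw [mul_zero] at this
        exact this.congr fun u => by rw [inv_div, div_eq_mul_inv]
      exact hE.comp this
    obtain ⟨B, -, hB⟩ := exists_forall_norm_gt
      ((tendsto_zero_iff_norm_tendsto_zero.1 ht).eventually_lt_const hε)
    refine ⟨max B (|τ| * R₁), le_max_right _ _, fun u hu' => ?_⟩
    have hu1 := hu u ((le_max_right _ _).trans_lt hu')
    set e := E (u / τ)⁻¹ with he
    refine ⟨Real.cosh (u.im - e.re), e.im, Real.one_le_cosh _,
      (Complex.abs_im_le_norm _).trans (hB u ((le_max_left _ _).trans_lt hu')).le, ?_⟩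
    have hpath : HasDerivAt (fun y : ℝ => (⟨u.re, y⟩ : ℂ) / τ) (Complex.I / τ) u.im := by
      have h1 : HasDerivAt (fun y : ℝ => (u.re : ℂ) + y * Complex.I) Complex.I u.im := by
        simpa using ((Complex.ofRealCLM.hasDerivAt (x := u.im)).mul_const Complex.I).const_add
          (u.re : ℂ)
      simpa only [Complex.mk_eq_add_mul_I] using h1.div_const (τ : ℂ)
    have hWd := h'.hasFDerivAt (u / τ) hu1
    have hcomp := (HasFDerivAt.comp_hasDerivAt (f := fun y : ℝ => (⟨u.re, y⟩ : ℂ) / τ) u.im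
      (by simpa using hWd) hpath)
    refine ((hcomp.sub_const w₀).const_mul
      (Complex.I * Complex.exp (-(c * Complex.I)) * τ)).congr_deriv ?_
    rw [weierstrassD_apply, hGE _ hu1, ← he]
    set a : ℂ := Complex.I * (τ * (u / τ) + c) + e with ha
    have ha' : a = ((e.re - u.im : ℝ) : ℂ) + ((u.re + c + e.im : ℝ) : ℂ) * Complex.I := by
      rw [ha, mul_div_cancel₀ _ hτ']
      apply Complex.ext
      · simp
        ring
      · simp
    have hcon : starRingEnd ℂ (1 / Complex.exp a * (Complex.I / τ)) =
        Complex.exp (((u.im - e.re : ℝ) : ℂ) + ((u.re + c + e.im : ℝ) : ℂ) * Complex.I) *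
          (-Complex.I / τ) := by
      rw [map_mul, map_div₀, map_div₀, map_one, ← Complex.exp_conj, Complex.conj_I,
        Complex.conj_ofReal, one_div, ← Complex.exp_neg]
      congr 2
      rw [ha']
      simp
      ring
    have hsplit : Complex.exp (((u.re + c + e.im : ℝ) : ℂ) * Complex.I) =
        Complex.exp (c * Complex.I) * Complex.exp (Complex.I * ((u.re + e.im : ℝ) : ℂ)) := by
      rw [← Complex.exp_add]
      congr 1
      push_cast
      ring
    have hcc : Complex.exp (-(c * Complex.I)) * Complex.exp (c * Complex.I) = 1 := by
      rw [← Complex.exp_add, neg_add_cancel, Complex.exp_zero]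
    rw [hcon, ha', Complex.exp_add, Complex.exp_add, hsplit, Complex.ofReal_cosh, Complex.cosh,
      mul_one]
    have hneg : -((u.im - e.re : ℝ) : ℂ) = ((e.re - u.im : ℝ) : ℂ) := by push_cast; ring
    rw [hneg]
    set P := Complex.exp ((u.im - e.re : ℝ) : ℂ)
    set M := Complex.exp ((e.re - u.im : ℝ) : ℂ)
    set Q := Complex.exp (Complex.I * ((u.re + e.im : ℝ) : ℂ))
    set c₁ := Complex.exp (-(c * Complex.I))
    set c₂ := Complex.exp (c * Complex.I)
    field_simp
    linear_combination (P + M) * Q * hcc - c₁ * c₂ * (P + M) * Q * Complex.I_sq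

end IsEndData

/-! ### Ends with double poles that contain a vertical ray -/

/-- The point of space with horizontal part `w₀ + k w` and height `t / τ`. -/
def similar (τ : ℝ) (k w₀ w : ℂ) (t : ℝ) : E3 :=
  !₂[(w₀ + k * w).re, (w₀ + k * w).im, t / τ]

/-- The image of the helicoid `{(s exp (i t), t)}` under the similarity `similar τ k w₀`. -/
def similarHelicoid (τ : ℝ) (k w₀ : ℂ) : Set E3 :=
  {q | ∃ s t : ℝ, q = similar τ k w₀ (s * Complex.exp (Complex.I * t)) t}

theorem norm_le_sum_abs (q : E3) : ‖q‖ ≤ |q 0| + |q 1| + |q 2| := by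
  rw [EuclideanSpace.norm_eq, Fin.sum_univ_three]
  refine Real.sqrt_le_iff.2 ⟨by positivity, ?_⟩
  simp only [Real.norm_eq_abs]
  nlinarith [mul_nonneg (abs_nonneg (q 0)) (abs_nonneg (q 1)),
    mul_nonneg (abs_nonneg (q 0)) (abs_nonneg (q 2)),
    mul_nonneg (abs_nonneg (q 1)) (abs_nonneg (q 2))]

theorem similar_injective {τ : ℝ} {k w₀ w w' : ℂ} {t t' : ℝ} (hτ : τ ≠ 0) (hk : k ≠ 0)
    (h : similar τ k w₀ w t = similar τ k w₀ w' t') : w = w' ∧ t = t' := by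
  have h0 : (w₀ + k * w).re = (w₀ + k * w').re := by
    simpa [similar] using congrArg (fun q : E3 => q 0) h
  have h1 : (w₀ + k * w).im = (w₀ + k * w').im := by
    simpa [similar] using congrArg (fun q : E3 => q 1) h
  have h2 : t / τ = t' / τ := by
    simpa [similar] using congrArg (fun q : E3 => q 2) h
  exact ⟨mul_left_cancel₀ hk (add_left_cancel (Complex.ext h0 h1)), (div_left_inj' hτ).1 h2⟩

theorem dist_similar_le (τ : ℝ) (k w₀ w : ℂ) (t t' : ℝ) :
    dist (similar τ k w₀ w t) (similar τ k w₀ w t') ≤ |t - t'| / |τ| := by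
  rw [dist_eq_norm]
  refine (norm_le_sum_abs _).trans (le_of_eq ?_)
  rw [← abs_div]
  simp [similar, sub_div]

theorem norm_similar_le (τ : ℝ) (k w₀ w : ℂ) (t : ℝ) :
    ‖similar τ k w₀ w t‖ ≤ 2 * (‖w₀‖ + ‖k‖ * ‖w‖) + |t| / |τ| := by
  refine (norm_le_sum_abs _).trans ?_
  have h1 : ‖w₀ + k * w‖ ≤ ‖w₀‖ + ‖k‖ * ‖w‖ := (norm_add_le _ _).trans (by rw [norm_mul])
  have h2 := Complex.abs_re_le_norm (w₀ + k * w)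
  have h3 := Complex.abs_im_le_norm (w₀ + k * w)
  rw [← abs_div]
  change |(w₀ + k * w).re| + |(w₀ + k * w).im| + |t / τ| ≤ _
  linarith

theorem le_norm_similar {τ : ℝ} (hτ : τ ≠ 0) (k w₀ w : ℂ) (t : ℝ) :
    |t| + ‖k * w‖ ≤ (|τ| + 2) * ‖similar τ k w₀ w t‖ + ‖w₀‖ := by
  have h0 : |(w₀ + k * w).re| ≤ ‖similar τ k w₀ w t‖ :=
    PiLp.norm_apply_le (similar τ k w₀ w t) 0
  have h1 : |(w₀ + k * w).im| ≤ ‖similar τ k w₀ w t‖ :=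
    PiLp.norm_apply_le (similar τ k w₀ w t) 1
  have h2 : |t / τ| ≤ ‖similar τ k w₀ w t‖ :=
    PiLp.norm_apply_le (similar τ k w₀ w t) 2
  have h3 := Complex.norm_le_abs_re_add_abs_im (w₀ + k * w)
  have h4 : ‖k * w‖ ≤ ‖w₀ + k * w‖ + ‖w₀‖ := by
    simpa using norm_sub_le (w₀ + k * w) w₀
  rw [abs_div, div_le_iff₀ (abs_pos.2 hτ)] at h2
  linarith

theorem isHelicoid_similarHelicoid {τ : ℝ} {κ : ℂ} (hτ : τ ≠ 0) (hκ : ‖κ‖ = 1) (w₀ : ℂ) :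
    IsHelicoid (similarHelicoid τ (κ / τ) w₀) := by
  have hκ2 : κ.re * κ.re + κ.im * κ.im = 1 := by
    rw [← Complex.normSq_apply, Complex.normSq_eq_norm_sq, hκ, one_pow]
  set v : Fin 3 → E3 := ![!₂[κ.re, κ.im, 0], !₂[-κ.im, κ.re, 0], !₂[0, 0, 1]] with hv
  have hon : Orthonormal ℝ v := by
    have hin : ∀ a b : E3, inner ℝ a b = a 0 * b 0 + a 1 * b 1 + a 2 * b 2 := fun a b => by
      simp only [PiLp.inner_apply, Fin.sum_univ_three, RCLike.inner_apply, conj_trivial]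
      ring
    rw [orthonormal_iff_ite]
    intro i j
    rw [hin]
    fin_cases i <;> fin_cases j <;> simp [hv] <;> linarith
  obtain ⟨e, he⟩ := Orthonormal.exists_orthonormalBasis_extension_of_card_eq
    (ι := Fin 3) (𝕜 := ℝ) (E := E3) (by simp) (v := v) (s := Set.univ)
    (hon.comp _ Subtype.val_injective)
  have hτ' : (τ : ℂ) ≠ 0 := Complex.ofReal_ne_zero.2 hτ
  refine ⟨similar τ (κ / τ) w₀ 0 0, e, τ⁻¹, inv_ne_zero hτ, ?_⟩
  have key : ∀ s t : ℝ, similar τ (κ / τ) w₀ ((τ * s : ℝ) * Complex.exp (Complex.I * t)) t =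
      similar τ (κ / τ) w₀ 0 0 + s • (Real.cos t • e 0 + Real.sin t • e 1) + (τ⁻¹ * t) • e 2 := by
    intro s t
    have e1 : κ / τ * (((τ * s : ℝ) : ℂ) * Complex.exp (Complex.I * t)) =
        s * (κ * Complex.exp (t * Complex.I)) := by
      push_cast
      rw [mul_comm Complex.I]
      field_simp
    rw [he 0 trivial, he 1 trivial, he 2 trivial]
    ext i
    fin_cases i
    · change (w₀ + κ / τ * (((τ * s : ℝ) : ℂ) * Complex.exp (Complex.I * t))).re = _
      rw [e1]
      simp [similar, hv, Complex.exp_ofReal_mul_I_re, Complex.exp_ofReal_mul_I_im]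
      ring
    · change (w₀ + κ / τ * (((τ * s : ℝ) : ℂ) * Complex.exp (Complex.I * t))).im = _
      rw [e1]
      simp [similar, hv, Complex.exp_ofReal_mul_I_re, Complex.exp_ofReal_mul_I_im]
      ring
    · simp [similar, hv]
      ring
  ext q
  constructor
  · rintro ⟨s, t, rfl⟩
    refine ⟨s / τ, t, ?_⟩
    rw [← key, mul_div_cancel₀ _ hτ]
  · rintro ⟨s, t, rfl⟩
    exact ⟨τ * s, t, (key s t).symm⟩

/-- An end with double poles and without residue that contains a vertical ray is, in a suitable
coordinate at infinity, the image of a map satisfying `IsHelicoidal` under a similarity. -/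
theorem exists_helicoidal_chart {X : ℂ → E3} (hX : ∀ᶠ z in 𝓝[≠] 0, ConformalAt X z)
    (hg : HasDoublePole (logDeriv (gaussMap X))) (hh : HasDoublePole (heightForm X))
    (hres : HasNoResidue (heightForm X))
    (hray : ∃ p v : E3, IsVertical v ∧ ∀ ρ > 0, ∃ s₀ : ℝ, ∀ s ≥ s₀,
      ∃ z : ℂ, 0 < ‖z‖ ∧ ‖z‖ < ρ ∧ X z = p + s • v) :
    ∃ (τ R : ℝ) (κ w₀ : ℂ) (V ψ θ : ℂ → ℂ), τ ≠ 0 ∧ ‖κ‖ = 1 ∧ IsHelicoidal V R ∧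
      Tendsto ψ (Bornology.cobounded ℂ) (𝓝[≠] 0) ∧ Tendsto θ (𝓝[≠] 0) (Bornology.cobounded ℂ) ∧
      (∀ᶠ z in 𝓝[≠] 0, ψ (θ z) = z) ∧
      ∀ u, R < ‖u‖ → X (ψ u) = similar τ (κ / τ) w₀ (V u) u.re := by
  obtain ⟨R, ψ, θ, W, G, L, hC, hD⟩ := exists_endChart hX hg hh hres
  obtain ⟨p, v, ⟨hv, hv0, hv1⟩, hray⟩ := hray
  have hv2 : v 2 ≠ 0 := fun h2 => hv (by
    ext i
    fin_cases i <;> simpa)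
  have hev : ∀ᶠ z in 𝓝 (0 : ℂ), z ∈ ({0}ᶜ : Set ℂ) → ψ (θ z) = z ∧ R + 1 ≤ ‖θ z‖ :=
    eventually_nhdsWithin_iff.1 (hC.left_inv.and (hC.tendsto_coord.eventually
      ((hasBasis_cobounded_norm (E := ℂ)).mem_of_mem trivial)))
  obtain ⟨ρ, hρ, hρP⟩ := exists_forall_norm_lt hev
  obtain ⟨s₀, hs₀⟩ := hray ρ hρ
  obtain ⟨y₀, hy₀⟩ := hD.exists_axis (w₀ := (p 0 : ℂ) + Complex.I * p 1)
    (S := (fun s : ℝ => p 2 + s * v 2) '' Set.Ici s₀) (fun hc => by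
      have hinj : Function.Injective fun s : ℝ => p 2 + s * v 2 := fun a b hab =>
        mul_right_cancel₀ hv2 (add_left_cancel hab)
      have := (Set.countable_of_injective_of_countable_image hinj.injOn hc).measure_zero volume
      simp at this) (by
      rintro _ ⟨s, hs, rfl⟩
      obtain ⟨z, h1, h2, h3⟩ := hs₀ s hs
      obtain ⟨h4, h5⟩ := hρP z h2 (norm_pos_iff.1 h1)
      have h6 := hC.horizontal (θ z) (by linarith)
      have h7 := hC.height (θ z) (by linarith)
      rw [h4, h3] at h6 h7
      refine ⟨θ z, h5, ?_, ?_⟩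
      · rw [← h7]; simp
      · rw [← h6]; simp [hv0, hv1])
  set w₀ : ℂ := (p 0 : ℂ) + Complex.I * p 1 with hw₀
  have hC' := hC.translate y₀
  obtain ⟨τ, c, R', hτ, hRR', hV⟩ := (hD.translate y₀).exists_isHelicoidal (w₀ := w₀) fun B => by
    obtain ⟨x, h1, h2, h3, h4⟩ := hy₀ (max B 0)
    refine ⟨x, (le_max_left _ _).trans_lt h1, ?_, h3, h4⟩
    have hx : (x : ℂ) ≠ 0 :=
      Complex.ofReal_ne_zero.2 (abs_pos.1 ((le_max_right _ _).trans_lt h1))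
    rw [← h2]
    congr 2
    field_simp
  have hτ' : (τ : ℂ) ≠ 0 := Complex.ofReal_ne_zero.2 hτ
  have hτp : 0 < |τ| := abs_pos.2 hτ
  have hmul : ∀ a : ℂ, a ≠ 0 → Tendsto (fun u => u * a) (Bornology.cobounded ℂ)
      (Bornology.cobounded ℂ) := fun a ha => tendsto_mul_right_cobounded ha
  refine ⟨τ, R', -Complex.I * Complex.exp (c * Complex.I), w₀, _,
    fun u => ψ (u / τ + y₀ * Complex.I), fun z => (θ z - y₀ * Complex.I) * τ, hτ, ?_, hV,
    ?_, (hmul _ hτ').comp hC'.tendsto_coord, ?_, fun u hu => ?_⟩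
  · rw [norm_mul, norm_neg, Complex.norm_I, Complex.norm_exp_ofReal_mul_I, one_mul]
  · simp only [div_eq_mul_inv]
    exact hC'.tendsto_param.comp (hmul _ (inv_ne_zero hτ'))
  · filter_upwards [hC'.left_inv] with z hz
    rwa [mul_div_cancel_right₀ _ hτ']
  · have hu' : R + |y₀| < ‖u / τ‖ := by
      rw [norm_div, Complex.norm_real, Real.norm_eq_abs, lt_div_iff₀ hτp, mul_comm]
      exact hRR'.trans_lt hu
    have h1 := hC'.horizontal _ hu'
    have h2 := hC'.height _ hu'
    set q := X (ψ (u / τ + y₀ * Complex.I)) with hq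
    have hcc : Complex.exp (-(c * Complex.I)) * Complex.exp (c * Complex.I) = 1 := by
      rw [← Complex.exp_add, neg_add_cancel, Complex.exp_zero]
    have h3 : w₀ + -Complex.I * Complex.exp (c * Complex.I) / τ *
        (Complex.I * Complex.exp (-(c * Complex.I)) * τ * (W (u / τ + y₀ * Complex.I) - w₀)) =
        (q 0 : ℂ) + Complex.I * q 1 := by
      rw [h1]
      generalize W (u / τ + y₀ * Complex.I) = ω
      generalize Complex.exp (-(c * Complex.I)) = c₁ at hcc ⊢
      generalize Complex.exp (c * Complex.I) = c₂ at hcc ⊢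
      field_simp
      linear_combination (ω - w₀) * hcc - c₁ * c₂ * (ω - w₀) * Complex.I_sq
    ext i
    fin_cases i
    · refine Eq.trans ?_ (congrArg Complex.re h3).symm
      simp
    · refine Eq.trans ?_ (congrArg Complex.im h3).symm
      simp
    · change q 2 = u.re / τ
      rw [h2, Complex.div_ofReal_re]

/-- The structure of an end with double poles and without residue that contains a vertical ray: it
is injective, goes to infinity and is asymptotic to a helicoid. -/
theorem end_asymptotic {X : ℂ → E3} (hX : ∀ᶠ z in 𝓝[≠] 0, ConformalAt X z)
    (hg : HasDoublePole (logDeriv (gaussMap X))) (hh : HasDoublePole (heightForm X))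
    (hres : HasNoResidue (heightForm X))
    (hray : ∃ p v : E3, IsVertical v ∧ ∀ ρ > 0, ∃ s₀ : ℝ, ∀ s ≥ s₀,
      ∃ z : ℂ, 0 < ‖z‖ ∧ ‖z‖ < ρ ∧ X z = p + s • v) :
    (∃ ρ > 0, Set.InjOn X {z | 0 < ‖z‖ ∧ ‖z‖ < ρ}) ∧
    Tendsto (fun z => ‖X z‖) (𝓝[≠] 0) atTop ∧
    ∃ H, IsHelicoid H ∧ (∀ ε > 0, ∀ᶠ z in 𝓝[≠] 0, ∃ q ∈ H, dist (X z) q < ε) ∧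
      ∀ ε > 0, ∀ r > 0, ∃ R : ℝ, ∀ q ∈ H, R < ‖q‖ →
        ∃ z, (0 < ‖z‖ ∧ ‖z‖ ≤ r) ∧ dist q (X z) < ε := by
  obtain ⟨τ, R, κ, w₀, V, ψ, θ, hτ, hκ, hV, hψ, hθ, hψθ, hXψ⟩ :=
    exists_helicoidal_chart hX hg hh hres hray
  have hτp : 0 < |τ| := abs_pos.2 hτ
  have hk : κ / τ ≠ 0 := div_ne_zero (norm_pos_iff.1 (by rw [hκ]; exact one_pos))
    (Complex.ofReal_ne_zero.2 hτ)
  have hkn : ‖κ / τ‖ = |τ|⁻¹ := by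
    rw [norm_div, hκ, Complex.norm_real, Real.norm_eq_abs, one_div]
  -- everything that holds near infinity holds near the puncture
  have hfar : ∀ B : ℝ, ∀ᶠ z in 𝓝[≠] (0 : ℂ), (R < ‖θ z‖ ∧ B < ‖θ z‖) ∧ ψ (θ z) = z ∧
      X z = similar τ (κ / τ) w₀ (V (θ z)) (θ z).re := fun B => by
    filter_upwards [hψθ, hθ.eventually ((hasBasis_cobounded_norm (E := ℂ)).mem_of_mem
      (i := max R B + 1) trivial)] with z h1 h2
    have h2' : max R B + 1 ≤ ‖θ z‖ := h2
    have hR : R < ‖θ z‖ := by linarith [le_max_left R B]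
    refine ⟨⟨hR, by linarith [le_max_right R B]⟩, h1, ?_⟩
    rw [← hXψ _ hR, h1]
  refine ⟨?_, ?_, similarHelicoid τ (κ / τ) w₀, isHelicoid_similarHelicoid hτ hκ w₀, ?_, ?_⟩
  · obtain ⟨B, hB, hinj⟩ := hV.exists_injOn
    obtain ⟨ρ, hρ, hP⟩ := exists_forall_norm_lt (eventually_nhdsWithin_iff.1 (hfar B))
    refine ⟨ρ, hρ, fun z hz z' hz' heq => ?_⟩
    obtain ⟨⟨-, h1⟩, h2, h3⟩ := hP z hz.2 (norm_pos_iff.1 hz.1)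
    obtain ⟨⟨-, h1'⟩, h2', h3'⟩ := hP z' hz'.2 (norm_pos_iff.1 hz'.1)
    rw [h3, h3'] at heq
    obtain ⟨h4, h5⟩ := similar_injective hτ hk heq
    rw [← h2, ← h2', hinj _ _ h1 h1' h5 h4]
  · refine tendsto_atTop.2 fun M => ?_
    obtain ⟨B, hB, hprop⟩ := hV.proper (max 1 |τ| * ((|τ| + 2) * |M| + ‖w₀‖))
    filter_upwards [hfar B] with z hz
    obtain ⟨⟨-, h1⟩, h2, h3⟩ := hz
    by_contra! hlt
    have h4 := hprop _ h1
    have h5 := le_norm_similar hτ (κ / τ) w₀ (V (θ z)) (θ z).re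
    rw [← h3, norm_mul, hkn] at h5
    have h6 : |(θ z).re| + |τ|⁻¹ * ‖V (θ z)‖ ≤ (|τ| + 2) * |M| + ‖w₀‖ := by
      refine h5.trans ?_
      gcongr
      exact hlt.le.trans (le_abs_self M)
    have h7 : |(θ z).re| + ‖V (θ z)‖ ≤
        max 1 |τ| * (|(θ z).re| + |τ|⁻¹ * ‖V (θ z)‖) := by
      rw [mul_add]
      gcongr
      · exact le_mul_of_one_le_left (abs_nonneg _) (le_max_left _ _)
      · calc ‖V (θ z)‖ = |τ| * (|τ|⁻¹ * ‖V (θ z)‖) := by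
              rw [mul_inv_cancel_left₀ hτp.ne']
          _ ≤ _ := by gcongr; exact le_max_right _ _
    have h8 : max 1 |τ| * (|(θ z).re| + |τ|⁻¹ * ‖V (θ z)‖) ≤
        max 1 |τ| * ((|τ| + 2) * |M| + ‖w₀‖) := by gcongr
    linarith
  · intro ε hε
    obtain ⟨B, hB, hmem⟩ := hV.exists_eq_mul_exp (ε := |τ| * (ε / 2)) (by positivity)
    filter_upwards [hfar B] with z hz
    obtain ⟨⟨-, h1⟩, h2, h3⟩ := hz
    obtain ⟨s, t, h4, h5⟩ := hmem _ h1
    refine ⟨_, ⟨s, t, rfl⟩, ?_⟩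
    rw [h3, h4]
    refine (dist_similar_le _ _ _ _ _ _).trans_lt ?_
    rw [div_lt_iff₀ hτp]
    nlinarith
  · intro ε hε r hr
    have hψr : ∀ᶠ u in Bornology.cobounded ℂ, 0 < ‖ψ u‖ ∧ ‖ψ u‖ ≤ r := by
      refine hψ.eventually (p := fun z => 0 < ‖z‖ ∧ ‖z‖ ≤ r) ?_
      filter_upwards [self_mem_nhdsWithin,
        nhdsWithin_le_nhds (Metric.closedBall_mem_nhds (0 : ℂ) hr)] with z h1 h2
      exact ⟨norm_pos_iff.2 h1, by simpa using h2⟩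
    obtain ⟨B₀, -, hB₀⟩ := exists_forall_norm_gt hψr
    obtain ⟨R', hR'⟩ := hV.exists_of_far (ε := min (1 / 4) (|τ| * (ε / 2))) (by positivity)
      (min_le_left _ _) B₀
    refine ⟨2 * ‖w₀‖ + 2 * |τ|⁻¹ * |R'|, ?_⟩
    rintro _ ⟨s, t, rfl⟩ hq
    have h1 := hq.trans_le (norm_similar_le _ _ _ _ _)
    rw [hkn, norm_mul, norm_exp_I_mul, mul_one, Complex.norm_real, Real.norm_eq_abs,
      div_eq_mul_inv] at h1
    have hτi : 0 < |τ|⁻¹ := inv_pos.2 hτp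
    have h2 : R' < |s| + |t| := by
      have h3 : |τ|⁻¹ * |R'| < |τ|⁻¹ * (|s| + |t|) := by
        nlinarith [mul_nonneg (abs_nonneg t) hτi.le]
      exact (le_abs_self R').trans_lt (lt_of_mul_lt_mul_left h3 hτi.le)
    obtain ⟨u, hu, huR, huV, hut⟩ := hR' s t h2
    refine ⟨ψ u, hB₀ u hu, ?_⟩
    rw [hXψ u huR, huV]
    refine (dist_similar_le _ _ _ _ _ _).trans_lt ?_
    rw [div_lt_iff₀ hτp, abs_sub_comm]
    have := hut.trans (min_le_right _ _)
    nlinarith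

/-! ### Embeddedness of the ends -/

/-- An injective end that goes to infinity at the puncture is proper, hence embedded. -/
theorem isEmbeddedSubEnd_of_injOn {X : ℂ → E3} {r : ℝ} (hc : ContinuousOn X (puncturedDisk r))
    (hinj : Set.InjOn X (puncturedDisk r)) (ht : Tendsto (fun z => ‖X z‖) (𝓝[≠] 0) atTop) :
    IsEmbeddedSubEnd X r := by
  have hc' : Continuous fun z : puncturedDisk r => X z := continuousOn_iff_continuous_domRestrict.1 hc
  have hprop : IsProperMap fun z : puncturedDisk r => X z := by
    refine isProperMap_iff_tendsto_cocompact.2 ⟨hc', ?_⟩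
    rw [← Metric.cobounded_eq_cocompact (α := E3), ← tendsto_norm_atTop_iff_cobounded]
    refine tendsto_atTop.2 fun M => ?_
    obtain ⟨δ, hδ, hP⟩ := exists_forall_norm_lt
      (eventually_nhdsWithin_iff.1 (tendsto_atTop.1 ht M))
    refine mem_cocompact.2 ⟨{z | δ ≤ ‖(z : ℂ)‖}, ?_, fun z hz => ?_⟩
    · rw [Subtype.isCompact_iff]
      have : Subtype.val '' {z : puncturedDisk r | δ ≤ ‖(z : ℂ)‖} =
          Metric.closedBall 0 r ∩ {z : ℂ | δ ≤ ‖z‖} := by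
        ext z
        constructor
        · rintro ⟨w, hw, rfl⟩
          exact ⟨by simpa using w.2.2, hw⟩
        · rintro ⟨h1, h2⟩
          exact ⟨⟨z, hδ.trans_le h2, by simpa using h1⟩, h2, rfl⟩
      rw [this]
      exact (isCompact_closedBall _ _).inter_right (isClosed_le continuous_const continuous_norm)
    · exact hP z (not_le.1 hz) (norm_pos_iff.1 z.2.1)
  exact (IsClosedEmbedding.of_continuous_injective_isClosedMap hc'
    (fun z w h => Subtype.ext (hinj z.2 w.2 h)) hprop.isClosedMap).isEmbedding

/-- The far part of a ray leaves every bounded set. -/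
theorem exists_forall_ray_norm_gt (p : E3) {v : E3} (hv : v ≠ 0) (M : ℝ) :
    ∃ s₀ ≥ (0 : ℝ), ∀ s ≥ s₀, M < ‖p + s • v‖ := by
  have hvp : 0 < ‖v‖ := norm_pos_iff.2 hv
  refine ⟨(|M| + ‖p‖ + 1) / ‖v‖, by positivity, fun s hs => ?_⟩
  have h1 : |M| + ‖p‖ + 1 ≤ s * ‖v‖ := (div_le_iff₀ hvp).1 hs
  have h2 : ‖s • v‖ ≤ ‖p + s • v‖ + ‖p‖ := by simpa using norm_sub_le (p + s • v) p
  rw [norm_smul, Real.norm_eq_abs] at h2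
  have h3 : s * ‖v‖ ≤ |s| * ‖v‖ := by gcongr; exact le_abs_self s
  linarith [le_abs_self M]

theorem annularEnd_embedded_asymptotic {X : ℂ → E3} (hX : IsCompleteMinimalAnnularEnd X)
    (hg : HasDoublePole (logDeriv (gaussMap X))) (hh : HasDoublePole (heightForm X))
    (hres : HasNoResidue (heightForm X))
    (hray : ∃ p v : E3, IsVertical v ∧ ray p v ⊆ X '' puncturedDisk 1) :
    ∃ r ∈ Set.Ioc (0 : ℝ) 1, IsEmbeddedSubEnd X r ∧
      ∃ H : Set E3, IsHelicoid H ∧ IsAsymptoticTo X r H := by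
  have hconf : ∀ᶠ z in 𝓝[≠] (0 : ℂ), ConformalAt X z := by
    filter_upwards [self_mem_nhdsWithin,
      nhdsWithin_le_nhds (Metric.ball_mem_nhds (0 : ℂ) one_pos)] with z h1 h2
    exact hX.minimal.conformalAt z ⟨norm_pos_iff.2 h1, by simpa using h2⟩
  obtain ⟨p, v, hv, hpv⟩ := hray
  obtain ⟨⟨ρ, hρ, hinj⟩, ht, H, hH, h1, h2⟩ := end_asymptotic hconf hg hh hres
    ⟨p, v, hv, fun ρ hρ => by
      have hK : IsCompact (Metric.closedBall (0 : ℂ) 1 ∩ {z | ρ ≤ ‖z‖}) :=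
        (isCompact_closedBall _ _).inter_right (isClosed_le continuous_const continuous_norm)
      obtain ⟨M, hM⟩ := hK.exists_bound_of_continuousOn
        (hX.continuousOn.mono fun z hz => ⟨hρ.trans_le hz.2, by simpa using hz.1⟩)
      obtain ⟨s₀, hs₀, hs⟩ := exists_forall_ray_norm_gt p hv.1 M
      refine ⟨s₀, fun s hs' => ?_⟩
      obtain ⟨z, hz, hzX⟩ := hpv ⟨s, hs₀.trans hs', rfl⟩
      refine ⟨z, hz.1, ?_, hzX⟩
      by_contra! hle
      have h3 := hM z ⟨by simpa using hz.2, hle⟩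
      rw [hzX] at h3
      linarith [hs s hs']⟩
  set r := min (ρ / 2) 1 with hr
  have hr0 : 0 < r := by positivity
  have hrρ : r < ρ := (min_le_left _ _).trans_lt (by linarith)
  refine ⟨r, ⟨hr0, min_le_right _ _⟩, isEmbeddedSubEnd_of_injOn
    (hX.continuousOn.mono fun z hz => ⟨hz.1, hz.2.trans (min_le_right _ _)⟩)
    (hinj.mono (show puncturedDisk r ⊆ {z | 0 < ‖z‖ ∧ ‖z‖ < ρ} from fun z hz => ⟨hz.1, hz.2.trans_lt hrρ⟩)) ht, H, hH, fun ε hε => ⟨?_, ?_⟩⟩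
  · obtain ⟨δ, hδ, hP⟩ := exists_forall_norm_lt (eventually_nhdsWithin_iff.1 (h1 ε hε))
    refine ⟨min (δ / 2) r, ⟨by positivity, min_le_right _ _⟩, fun z hz => ?_⟩
    exact hP z (hz.2.trans_lt ((min_le_left _ _).trans_lt (by linarith))) (norm_pos_iff.1 hz.1)
  · exact h2 ε hε r hr0

/-! ### The genus one helicoid -/

section Torus

variable {L : PeriodPair}

/-- Away from the puncture a surface parametrised by a punctured torus is bounded: far out points
come from a small punctured disk. -/
theorem exists_lift_of_norm_gt {Y : ℂ ⧸ L.lattice → E3}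
    (hc : ContinuousOn (torusLift L Y) (puncturedPlane L)) {ρ : ℝ} (hρ : 0 < ρ) :
    ∃ M : ℝ, ∀ q ∈ puncturedTorus L, M < ‖Y q‖ →
      ∃ z : ℂ, 0 < ‖z‖ ∧ ‖z‖ < ρ ∧ L.lattice.mkQ z = q := by
  set N : Set ℂ := ⋃ l ∈ L.lattice, Metric.ball l ρ with hN
  have hNo : IsOpen N := isOpen_biUnion fun _ _ => Metric.isOpen_ball
  have hK : IsCompact (Metric.closedBall (0 : ℂ) (∑ i, ‖L.basis i‖) \ N) :=
    (isCompact_closedBall _ _).diff hNo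
  obtain ⟨M, hM⟩ := hK.exists_bound_of_continuousOn (hc.mono fun z hz hzl =>
    hz.2 (Set.mem_biUnion (show z ∈ (L.lattice : Set ℂ) from hzl) (Metric.mem_ball_self hρ)))
  refine ⟨M, fun q hq hqM => ?_⟩
  obtain ⟨z, rfl⟩ := L.lattice.mkQ_surjective q
  set w := ZSpan.fract L.basis z with hw
  have hwz : L.lattice.mkQ w = L.lattice.mkQ z := by
    rw [hw, ZSpan.fract_apply, map_sub, sub_eq_self, Submodule.mkQ_apply,
      Submodule.Quotient.mk_eq_zero, L.lattice_eq_span_range_basis]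
    exact (ZSpan.floor L.basis z).2
  have hwN : w ∈ N := by
    by_contra hwN
    have := hM w ⟨by simpa using ZSpan.norm_fract_le L.basis z, hwN⟩
    rw [torusLift, hwz] at this
    linarith
  obtain ⟨l, hl, hwl⟩ := Set.mem_iUnion₂.1 hwN
  have hl0 : L.lattice.mkQ l = 0 := by
    rw [Submodule.mkQ_apply, Submodule.Quotient.mk_eq_zero]
    exact hl
  have hz : L.lattice.mkQ (w - l) = L.lattice.mkQ z := by
    rw [map_sub, hl0, sub_zero, hwz]
  refine ⟨w - l, norm_pos_iff.2 fun h0 => hq ?_, by rwa [← mem_ball_iff_norm], hz⟩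
  rw [← hz, h0, map_zero]

/-- Small punctured disks embed in the torus. -/
theorem exists_isEmbedding_mkQ (L : PeriodPair) :
    ∃ ρ > 0, ∀ r < ρ, IsEmbedding fun z : puncturedDisk r => L.lattice.mkQ z := by
  obtain ⟨δ, hδ, hball⟩ := Metric.mem_nhds_iff.1 (L.compl_lattice_sdiff_singleton_mem_nhds 0)
  have hinj : ∀ z ∈ Metric.ball (0 : ℂ) (δ / 2), ∀ w ∈ Metric.ball (0 : ℂ) (δ / 2),
      L.lattice.mkQ z = L.lattice.mkQ w → z = w := by
    intro z hz w hw h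
    rw [mem_ball_zero_iff] at hz hw
    have hmem : z - w ∈ L.lattice := (Submodule.Quotient.eq _).1 h
    have hlt : z - w ∈ Metric.ball (0 : ℂ) δ := by
      rw [mem_ball_zero_iff]
      linarith [norm_sub_le z w]
    by_contra hne
    exact hball hlt ⟨hmem, fun h0 => hne (sub_eq_zero.1 h0)⟩
  refine ⟨δ / 2, by positivity, fun r hr => ?_⟩
  have hopen : IsOpenEmbedding fun z : Metric.ball (0 : ℂ) (δ / 2) => L.lattice.mkQ z := by
    have hq : IsOpenQuotientMap L.lattice.mkQ := L.lattice.isOpenQuotientMap_mkQL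
    refine .of_continuous_injective_isOpenMap (hq.continuous.comp continuous_subtype_val)
      (fun z w h => Subtype.ext (hinj z z.2 w w.2 h))
      (hq.isOpenMap.comp Metric.isOpen_ball.isOpenMap_subtype_val)
  have hsub : puncturedDisk r ⊆ Metric.ball (0 : ℂ) (δ / 2) := fun z hz => by
    rw [mem_ball_zero_iff]
    exact hz.2.trans_lt hr
  exact hopen.isEmbedding.comp (IsEmbedding.inclusion hsub)

theorem genusOneHelicoid_embedded_outside {Y : ℂ ⧸ L.lattice → E3} (hY : IsGenusOneHelicoid L Y) :
    ∃ K : Set E3, IsCompact K ∧ IsEmbeddedOutside L Y K := by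
  have hnear : ∀ᶠ z in 𝓝[≠] (0 : ℂ), z ∈ puncturedPlane L := by
    filter_upwards [self_mem_nhdsWithin,
      nhdsWithin_le_nhds (L.compl_lattice_sdiff_singleton_mem_nhds 0)] with z h1 h2 h3
    exact h2 ⟨h3, h1⟩
  have hc : ContinuousOn (torusLift L Y) (puncturedPlane L) := fun z hz =>
    (hY.minimal.conformalAt z hz).differentiableAt.continuousAt.continuousWithinAt
  obtain ⟨p, v, w, hv, -, hpv, -⟩ := hY.lines
  obtain ⟨⟨ρ, hρ, hinj⟩, ht, -⟩ := end_asymptotic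
    (hnear.mono fun z hz => hY.minimal.conformalAt z hz)
    hY.doublePole_gauss hY.doublePole_height hY.noResidue_height
    ⟨p, v, hv, fun ρ hρ => by
      obtain ⟨M, hM⟩ := exists_lift_of_norm_gt hc hρ
      obtain ⟨s₀, -, hs⟩ := exists_forall_ray_norm_gt p hv.1 M
      refine ⟨s₀, fun s hs' => ?_⟩
      obtain ⟨q, hq, hqY⟩ := hpv ⟨s, rfl⟩
      obtain ⟨z, h1, h2, h3⟩ := hM q hq (by rw [hqY]; exact hs s hs')
      exact ⟨z, h1, h2, by rw [torusLift, h3, hqY]⟩⟩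
  obtain ⟨ρ', hρ', hemb⟩ := exists_isEmbedding_mkQ L
  obtain ⟨ρ'', hρ'', hplane⟩ := exists_forall_norm_lt (eventually_nhdsWithin_iff.1 hnear)
  set r := min ρ (min ρ' ρ'') / 2 with hr
  have hm : 0 < min ρ (min ρ' ρ'') := by positivity
  have hr0 : 0 < r := by positivity
  have hr' : r < min ρ (min ρ' ρ'') := by linarith
  have hπ := hemb r (hr'.trans_le ((min_le_right _ _).trans (min_le_left _ _)))
  have hX : IsEmbeddedSubEnd (torusLift L Y) r := by
    refine isEmbeddedSubEnd_of_injOn (hc.mono fun z hz => ?_)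
      (hinj.mono (show puncturedDisk r ⊆ {z | 0 < ‖z‖ ∧ ‖z‖ < ρ} from fun z hz =>
        ⟨hz.1, hz.2.trans_lt (hr'.trans_le (min_le_left _ _))⟩)) ht
    exact hplane z (hz.2.trans_lt (hr'.trans_le ((min_le_right _ _).trans (min_le_right _ _))))
      (norm_pos_iff.1 hz.1)
  obtain ⟨M, hM⟩ := exists_lift_of_norm_gt hc hr0
  refine ⟨Metric.closedBall 0 M, isCompact_closedBall _ _, ?_⟩
  -- outside the ball, the surface factors through the embedded punctured disk
  have hsub : {q : ℂ ⧸ L.lattice | q ∈ puncturedTorus L ∧ Y q ∉ Metric.closedBall 0 M} ⊆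
      Set.range fun z : puncturedDisk r => L.lattice.mkQ z := by
    rintro q ⟨hq, hqM⟩
    obtain ⟨z, h1, h2, h3⟩ := hM q hq (by simpa using hqM)
    exact ⟨⟨z, h1, h2.le⟩, h3⟩
  have hfac := IsEmbedding.comp hX
    ((hπ.toHomeomorph.symm.isEmbedding).comp (IsEmbedding.inclusion hsub))
  have heq : (fun q : {q : ℂ ⧸ L.lattice // q ∈ puncturedTorus L ∧
      Y q ∉ Metric.closedBall 0 M} => Y q) =
      (fun z : puncturedDisk r => torusLift L Y z) ∘
        (hπ.toHomeomorph.symm ∘ Set.inclusion hsub) := by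
    funext q
    have h1 := congrArg Subtype.val (hπ.toHomeomorph.apply_symm_apply (Set.inclusion hsub q))
    have h2 : L.lattice.mkQ (hπ.toHomeomorph.symm (Set.inclusion hsub q) : puncturedDisk r) =
        (q : ℂ ⧸ L.lattice) := h1
    simp only [Function.comp_apply, torusLift, h2]
  rw [IsEmbeddedOutside, heq]
  exact hfac

end Torus

end HelicoidEnd

end

theorem theorem1 :
    (∀ X : ℂ → HelicoidEnd.E3,
      HelicoidEnd.IsCompleteMinimalAnnularEnd X →
      HelicoidEnd.HasDoublePole (logDeriv (HelicoidEnd.gaussMap X)) →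
      HelicoidEnd.HasDoublePole (HelicoidEnd.heightForm X) →
      HelicoidEnd.HasNoResidue (HelicoidEnd.heightForm X) →
      (∃ p v : HelicoidEnd.E3, HelicoidEnd.IsVertical v ∧
        HelicoidEnd.ray p v ⊆ X '' HelicoidEnd.puncturedDisk 1) →
      (∃ p v : HelicoidEnd.E3, HelicoidEnd.IsHorizontal v ∧
        HelicoidEnd.ray p v ⊆ X '' HelicoidEnd.puncturedDisk 1) →
      ∃ r ∈ Set.Ioc (0 : ℝ) 1, HelicoidEnd.IsEmbeddedSubEnd X r ∧
        ∃ H : Set HelicoidEnd.E3, HelicoidEnd.IsHelicoid H ∧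
          HelicoidEnd.IsAsymptoticTo X r H) ∧
    (∀ (L : PeriodPair) (Y : ℂ ⧸ L.lattice → HelicoidEnd.E3),
      HelicoidEnd.IsGenusOneHelicoid L Y →
      ∃ K : Set HelicoidEnd.E3, IsCompact K ∧ HelicoidEnd.IsEmbeddedOutside L Y K) :=
  ⟨fun _ hX hg hh hres hray _ =>
    HelicoidEnd.annularEnd_embedded_asymptotic hX hg hh hres hray,
    fun _ _ hY => HelicoidEnd.genusOneHelicoid_embedded_outside hY⟩
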